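/- **Setting.** Let $\mu\in(0,1/2]$. The Euler problem of two fixed centers has Hamiltonian $H(q,p)=\frac12|p|^2-\frac{1-\mu}{|q-E|}-\frac{\mu}{|q-M|}$ on the plane, with $E=(-\frac12,0)$ (Earth) and $M=(\frac12,0)$ (Moon). In the elliptic coordinates $\xi=|q-E|+|q-M|\ge 1$, $\eta=|q-E|-|q-M|\in[-1,1]$, with conjugate momenta $p_\xi,p_\eta$, put $H_\xi=2(\xi^2-1)p_\xi^2-2\xi$ and $H_\eta=2(1-\eta^2)p_\eta^2+2(1-2\mu)\eta$. Then $H=\frac{H_\xi+H_\eta}{\xi^2-\eta^2}$, and $G=-\frac{\eta^2H_\xi+\xi^2H_\eta}{\xi^2-\eta^2}$ is a first integral. On the level $(G,H)=(g,c)$, $c<0$, in the regularized time $\tau$ with $dt=(\xi^2-\eta^2)\,d\tau$, one has $\dot\xi^2=8f(\xi)$, $\dot\eta^2=8h(\eta)$ with $$f(\xi)=(c\xi^2+2\xi+g)(\xi^2-1),\qquad h(\eta)=(c\eta^2+2(1-2\mu)\eta+g)(\eta^2-1).$$ For a regular level let $\sqrt2\,\tau_\xi=\int d\xi/\sqrt{f(\xi)}$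 over the interval $\{\xi>1: f(\xi)>0\}$ and $\sqrt2\,\tau_\eta=\int d\eta/\sqrt{h(\eta)}$ over the interval of $\eta\in(-1,1)$ with $h>0$ that is adjacent to $-1$ (Earth component) or to $1$ (Moon component); these two intervals are both $(-1,1)$ if the motion surrounds both primaries. The rotation number of the corresponding Liouville tori is $R(g,c)=\tau_\eta/\tau_\xi$. The rotation number in $[0,\infty]$ of a critical orbit on the level $(g_0,c)$ is the limit of $R(g,c)$ as $g\to g_0$, $g\ne g_0$, through the values $g$ for which tori exist in the component(s) considered. Let $c_J=-1-2\sqrt{\mu(1-\mu)}$, $c_e=-1$, $c_h=-1+2\mu$. The critical orbits of energy $c$, with their values of $G$, are: - the interior collision orbit ($\xi=1$): $g=-c-2$, $c<c_J$, in either component; - the exterior collision orbit in the Earth component ($\eta=-1$): $g=-c+2(1-2\mu)$, $c<0$; - the exterior collision orbit in the Moon component ($\eta=1$): $g=-c-2(1-2\mu)$, $c<0$, $c\neq c_h$; - the double-collision orbit ($\xi=1$): $g=-c-2$, $c_J<c<0$, $c\ne c_e$; - the hyperbolic orbit ($\eta=-(1-2\mu)/c$): $gc=(1-2\mu)^2$,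 $c_J<c<c_h$; - the elliptic orbit ($\xi=-1/c$): $gc=1$, $c_e<c<0$. **Proposition.** The rotation numbers of all these orbits exist (for the interior, double-collision, hyperbolic and elliptic orbits, with the same value whether computed in the Earth or in the Moon component). Denote them, as functions of $c$, by $R_{\rm int}$, $R_{\rm ext}^{E}$, $R_{\rm ext}^{M}$, $R_{\rm dou}$, $R_{\rm hyp}$, $R_{\rm ell}$. Then: (a) $R_{\rm int}$ is strictly increasing on $(-\infty,c_J)$, with $\lim_{c\to-\infty}R_{\rm int}=1$ and $\lim_{c\to c_J^-}R_{\rm int}=\infty$. (b) $R_{\rm ext}^{E}$ is strictly increasing on $(-\infty,0)$, with $\lim_{c\to-\infty}R_{\rm ext}^{E}=1$; if $\mu=1/2$, then $\lim_{c\to0^-}R_{\rm ext}^{E}=\infty$. (c) $R_{\rm ext}^{M}$ is strictly increasing on $(-\infty,c_h)$, with $\lim_{c\to-\infty}R_{\rm ext}^{M}=1$ and $\lim_{c\to c_h^-}R_{\rm ext}^{M}=\infty$; and $R_{\rm ext}^{M}=\infty$ for every $c\in(c_h,0)$. (d) $R_{\rm dou}$ is strictly decreasing on $(c_J,c_e)$,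 with $\lim_{c\to c_J^+}R_{\rm dou}=\infty$ and $\lim_{c\to c_e^-}R_{\rm dou}=0$; and $R_{\rm dou}=0$ for every $c\in(c_e,0)$. (e) $R_{\rm hyp}=\infty$ for every $c\in(c_J,c_h)$. (f) $R_{\rm ell}$ is strictly increasing on $(c_e,0)$, with $\lim_{c\to c_e^+}R_{\rm ell}=0$ and $\lim_{c\to0^-}R_{\rm ell}=1$. -/

import Mathlib

open Filter Topology MeasureTheory
open scoped ENNReal

namespace EulerProblem

noncomputable section

/-! ### The Euler problem of two fixed centers -/

/-- The position of the Earth. -/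
def earthPos : EuclideanSpace ℝ (Fin 2) := !₂[-1 / 2, 0]

/-- The position of the Moon. -/
def moonPos : EuclideanSpace ℝ (Fin 2) := !₂[1 / 2, 0]

/-- The Hamiltonian of the Euler problem, with masses `1 - μ` (Earth) and `μ` (Moon). -/
def hamiltonian (μ : ℝ) (q p : EuclideanSpace ℝ (Fin 2)) : ℝ :=
  ‖p‖ ^ 2 / 2 - (1 - μ) / ‖q - earthPos‖ - μ / ‖q - moonPos‖

/-- The elliptic coordinate `ξ = |q - E| + |q - M| ∈ [1, ∞)`. -/
def coordXi (q : EuclideanSpace ℝ (Fin 2)) : ℝ := ‖q - earthPos‖ + ‖q - moonPos‖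

/-- The elliptic coordinate `η = |q - E| - |q - M| ∈ [-1, 1]`. -/
def coordEta (q : EuclideanSpace ℝ (Fin 2)) : ℝ := ‖q - earthPos‖ - ‖q - moonPos‖

/-- The momentum `p = a ∇ξ + b ∇η` whose components in elliptic coordinates are
`p_ξ = a` and `p_η = b`, i.e. `p₁ dq₁ + p₂ dq₂ = a dξ + b dη`. -/
def momentumOf (q : EuclideanSpace ℝ (Fin 2)) (a b : ℝ) : EuclideanSpace ℝ (Fin 2) :=
  (a + b) • (‖q - earthPos‖⁻¹ • (q - earthPos)) + (a - b) • (‖q - moonPos‖⁻¹ • (q - moonPos))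

/-- `H_ξ = 2 (ξ² - 1) p_ξ² - 2 ξ`. -/
def partXi (ξ a : ℝ) : ℝ := 2 * (ξ ^ 2 - 1) * a ^ 2 - 2 * ξ

/-- `H_η = 2 (1 - η²) p_η² + 2 (1 - 2μ) η`. -/
def partEta (μ η b : ℝ) : ℝ := 2 * (1 - η ^ 2) * b ^ 2 + 2 * (1 - 2 * μ) * η

/-- The Hamiltonian in elliptic coordinates. -/
def ellipticH (μ ξ η a b : ℝ) : ℝ := (partXi ξ a + partEta μ η b) / (ξ ^ 2 - η ^ 2)

/-- The first integral `G` in elliptic coordinates. -/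
def ellipticG (μ ξ η a b : ℝ) : ℝ :=
  -(η ^ 2 * partXi ξ a + ξ ^ 2 * partEta μ η b) / (ξ ^ 2 - η ^ 2)

/-- `ellipticH` is the Hamiltonian of the Euler problem written in elliptic coordinates. -/
theorem hamiltonian_eq_ellipticH (μ a b : ℝ) (q : EuclideanSpace ℝ (Fin 2))
    (hE : q ≠ earthPos) (hM : q ≠ moonPos) :
    hamiltonian μ q (momentumOf q a b) = ellipticH μ (coordXi q) (coordEta q) a b := by
  have h1 : 0 < ‖q - earthPos‖ := norm_pos_iff.2 (sub_ne_zero.2 hE)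
  have h2 : 0 < ‖q - moonPos‖ := norm_pos_iff.2 (sub_ne_zero.2 hM)
  have e1 : ‖q - earthPos‖ ^ 2 = (q 0 + 1 / 2) ^ 2 + q 1 ^ 2 := by
    rw [EuclideanSpace.norm_sq_eq]
    simp [Fin.sum_univ_two, earthPos]
    ring
  have e2 : ‖q - moonPos‖ ^ 2 = (q 0 - 1 / 2) ^ 2 + q 1 ^ 2 := by
    rw [EuclideanSpace.norm_sq_eq]
    simp [Fin.sum_univ_two, moonPos]
  have e3 : ‖momentumOf q a b‖ ^ 2 =
      ((a + b) * (‖q - earthPos‖⁻¹ * (q 0 + 1 / 2)) +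
        (a - b) * (‖q - moonPos‖⁻¹ * (q 0 - 1 / 2))) ^ 2 +
      ((a + b) * (‖q - earthPos‖⁻¹ * q 1) + (a - b) * (‖q - moonPos‖⁻¹ * q 1)) ^ 2 := by
    rw [EuclideanSpace.norm_sq_eq]
    simp [Fin.sum_univ_two, momentumOf, earthPos, moonPos, neg_div]
  unfold hamiltonian ellipticH partXi partEta coordXi coordEta
  rw [e3]
  generalize ‖q - earthPos‖ = r at *
  generalize ‖q - moonPos‖ = s at *
  generalize q 0 = x at *
  generalize q 1 = y at *
  have hy : y ^ 2 = r ^ 2 - (x + 1 / 2) ^ 2 := by linarith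
  have hx : x = (r ^ 2 - s ^ 2) / 2 := by linarith
  have hd : (r + s) ^ 2 - (r - s) ^ 2 = 4 * r * s := by ring
  rw [hd]
  have key : ((a + b) * (r⁻¹ * (x + 1 / 2)) + (a - b) * (s⁻¹ * (x - 1 / 2))) ^ 2 +
      ((a + b) * (r⁻¹ * y) + (a - b) * (s⁻¹ * y)) ^ 2 =
      ((a + b) * s * (x + 1 / 2) + (a - b) * r * (x - 1 / 2)) ^ 2 / (r * s) ^ 2 +
      ((a + b) * s + (a - b) * r) ^ 2 * y ^ 2 / (r * s) ^ 2 := by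
    field_simp
  rw [key, hy, hx]
  field_simp
  ring

/-! ### Separation of variables -/

/-- `f(ξ) = (c ξ² + 2 ξ + g) (ξ² - 1)`. -/
def f (g c ξ : ℝ) : ℝ := (c * ξ ^ 2 + 2 * ξ + g) * (ξ ^ 2 - 1)

/-- `h(η) = (c η² + 2 (1 - 2μ) η + g) (η² - 1)`. -/
def h (μ g c η : ℝ) : ℝ := (c * η ^ 2 + 2 * (1 - 2 * μ) * η + g) * (η ^ 2 - 1)

/-- The joint level `(G, H) = (g, c)` in elliptic coordinates, in terms of `f` and `h`. Since the
regularized motion (time `dt = (ξ² - η²) dτ`) satisfies `ξ' = 4 (ξ² - 1) p_ξ` and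
`η' = 4 (1 - η²) p_η`, this says that `ξ'² = 8 f(ξ)` and `η'² = 8 h(η)`. -/
theorem level_iff (μ g c ξ η a b : ℝ) (hξ : 1 < ξ) (hη : -1 < η) (hη' : η < 1) :
    (ellipticG μ ξ η a b = g ∧ ellipticH μ ξ η a b = c) ↔
      ((4 * (ξ ^ 2 - 1) * a) ^ 2 = 8 * f g c ξ ∧ (4 * (1 - η ^ 2) * b) ^ 2 = 8 * h μ g c η) := by
  have h1 : 0 < ξ ^ 2 - 1 := by nlinarith
  have h2 : 0 < 1 - η ^ 2 := by nlinarith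
  have h3 : 0 < ξ ^ 2 - η ^ 2 := by linarith
  have h4 : (4 * (ξ ^ 2 - 1) * a) ^ 2 = 8 * f g c ξ ↔ partXi ξ a = c * ξ ^ 2 + g := by
    have : (4 * (ξ ^ 2 - 1) * a) ^ 2 - 8 * f g c ξ =
        8 * (ξ ^ 2 - 1) * (partXi ξ a - (c * ξ ^ 2 + g)) := by
      unfold f partXi; ring
    rw [← sub_eq_zero, this, mul_eq_zero, or_iff_right (by positivity), sub_eq_zero]
  have h5 : (4 * (1 - η ^ 2) * b) ^ 2 = 8 * h μ g c η ↔ partEta μ η b = -(c * η ^ 2) - g := by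
    have : (4 * (1 - η ^ 2) * b) ^ 2 - 8 * h μ g c η =
        8 * (1 - η ^ 2) * (partEta μ η b - (-(c * η ^ 2) - g)) := by
      unfold h partEta; ring
    rw [← sub_eq_zero, this, mul_eq_zero, or_iff_right (by positivity), sub_eq_zero]
  rw [h4, h5]
  unfold ellipticG ellipticH
  rw [div_eq_iff h3.ne', div_eq_iff h3.ne']
  constructor
  · rintro ⟨e1, e2⟩
    constructor
    · apply mul_left_cancel₀ h3.ne'
      linear_combination e1 + ξ ^ 2 * e2
    · apply mul_left_cancel₀ h3.ne'
      linear_combination -e1 - η ^ 2 * e2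
  · rintro ⟨e1, e2⟩
    rw [e1, e2]
    constructor <;> ring

/-! ### Periods and rotation numbers -/

/-- The two primaries; they label the component (around the Earth or around the Moon) in which a
motion takes place. -/
inductive Primary where
  | earth
  | moon

/-- The interior of the range of `ξ` for the motions with `(G, H) = (g, c)`. For `c < 0` it is an
interval, possibly empty. -/
def xiRange (g c : ℝ) : Set ℝ := {ξ | 1 < ξ ∧ 0 < f g c ξ}

/-- The interior of the range of `η` for the motions with `(G, H) = (g, c)` that reach the segment
of the axis behind the given primary: the interval of admissible `η` which is adjacent to `-1`
(Earth) or to `1` (Moon). It is empty if there is no such motion. The two intervals are equal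
(to `(-1, 1)`) if the motion surrounds both primaries. -/
def etaRange (μ g c : ℝ) : Primary → Set ℝ
  | .earth => {η | -1 < η ∧ η < 1 ∧ ∀ t, -1 < t → t ≤ η → 0 < h μ g c t}
  | .moon => {η | -1 < η ∧ η < 1 ∧ ∀ t, η ≤ t → t < 1 → 0 < h μ g c t}

/-- The period of the `ξ`-oscillation, `√2 τ_ξ = ∫ dξ / √f(ξ)` over the range of `ξ`. -/
def tauXi (g c : ℝ) : ℝ≥0∞ :=
  ENNReal.ofReal (1 / √2) * ∫⁻ ξ in xiRange g c, ENNReal.ofReal (1 / √(f g c ξ))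

/-- The period of the `η`-oscillation, `√2 τ_η = ∫ dη / √h(η)` over the range of `η`. -/
def tauEta (k : Primary) (μ g c : ℝ) : ℝ≥0∞ :=
  ENNReal.ofReal (1 / √2) * ∫⁻ η in etaRange μ g c k, ENNReal.ofReal (1 / √(h μ g c η))

/-- The rotation function `R = τ_η / τ_ξ`. -/
def rotation (k : Primary) (μ g c : ℝ) : ℝ≥0∞ := tauEta k μ g c / tauXi g c

/-- The values `g` of the first integral for which there are nonconstant oscillations of both
coordinates at energy `c` in the component labelled by `k`. -/
def accessible (k : Primary) (μ c : ℝ) : Set ℝ :=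
  {g | (xiRange g c).Nonempty ∧ (etaRange μ g c k).Nonempty}

/-- `r` is the rotation number of the critical orbit with `(G, H) = (g₀, c)` in the component
labelled by `k`: the value at `g₀` of the continuous extension of the rotation function
`R_c = R(·, c)` of the neighbouring Liouville tori on the same energy hypersurface. (On a critical
orbit one of the two coordinates is constant, and its period is understood as this limit.) -/
def HasRotationNumber (k : Primary) (μ c g₀ : ℝ) (r : ℝ≥0∞) : Prop :=
  (𝓝[accessible k μ c \ {g₀}] g₀).NeBot ∧
    Tendsto (fun g => rotation k μ g c) (𝓝[accessible k μ c \ {g₀}] g₀) (𝓝 r)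

/-! ### Distinguished energies and critical orbits -/

/-- The critical Jacobi energy. -/
def cJ (μ : ℝ) : ℝ := -1 - 2 * √(μ * (1 - μ))

/-- The energy at which the elliptic orbit degenerates to the double-collision orbit. -/
def ce : ℝ := -1

/-- The energy at which the hyperbolic orbit degenerates to the exterior collision orbit in the
Moon component. -/
def ch (μ : ℝ) : ℝ := -1 + 2 * μ

/-- `r` is the rotation number of the interior collision orbit (`ξ = 1`, hence `c + 2 + g = 0`) of
energy `c < c_J`, in either component. -/
def IsRotInt (μ c : ℝ) (r : ℝ≥0∞) : Prop :=
  ∀ k : Primary, HasRotationNumber k μ c (-c - 2) r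

/-- `r` is the rotation number of the exterior collision orbit in the Earth component (`η = -1`,
hence `c - 2 (1 - 2μ) + g = 0`) of energy `c`. -/
def IsRotExtEarth (μ c : ℝ) (r : ℝ≥0∞) : Prop :=
  HasRotationNumber .earth μ c (-c + 2 * (1 - 2 * μ)) r

/-- `r` is the rotation number of the exterior collision orbit in the Moon component (`η = 1`,
hence `c + 2 (1 - 2μ) + g = 0`) of energy `c`. -/
def IsRotExtMoon (μ c : ℝ) (r : ℝ≥0∞) : Prop :=
  HasRotationNumber .moon μ c (-c - 2 * (1 - 2 * μ)) r

/-- `r` is the rotation number of the double-collision orbit (`ξ = 1`, hence `c + 2 + g = 0`) of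
energy `c > c_J`. -/
def IsRotDou (μ c : ℝ) (r : ℝ≥0∞) : Prop :=
  ∀ k : Primary, HasRotationNumber k μ c (-c - 2) r

/-- `r` is the rotation number of the hyperbolic orbit (`η` is the double root of
`c η² + 2 (1 - 2μ) η + g`, hence `g c = (1 - 2μ)²`) of energy `c ∈ (c_J, c_h)`. -/
def IsRotHyp (μ c : ℝ) (r : ℝ≥0∞) : Prop :=
  ∀ k : Primary, HasRotationNumber k μ c ((1 - 2 * μ) ^ 2 / c) r

/-- `r` is the rotation number of the elliptic orbit (`ξ` is the double root of `c ξ² + 2 ξ + g`,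
hence `g c = 1`) of energy `c ∈ (c_e, 0)`. -/
def IsRotEll (μ c : ℝ) (r : ℝ≥0∞) : Prop :=
  ∀ k : Primary, HasRotationNumber k μ c (1 / c) r

end

end EulerProblem

/-!
Write `γ = -c`, `δ = 1 - 2μ`, `κ = 2 √(μ (1 - μ))`, so that `κ² + δ² = 1`. Every period is an
integral `∫_a^b dx / √((x - a) (b - x) q(x))` with a quadratic polynomial `q`. The substitution
`x = (a + b λ t²) / (1 + λ t²)` with `λ² = q(a) / q(b)` brings it into the form
`ellInt e m = ∫₀^∞ 2 dt / √(m (t² - 1)² + e t²)`, where `m² = q(a) q(b)` and `e - 2m` is twice the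
polar form of `q` at `(a, b)` (`lintegral_quartic`). In this form the integrand is decreasing in `e`
and `m` and homogeneous of degree `-1/2`; the integral is continuous on `e, m > 0` and tends to `∞`
as one of the parameters tends to `0`. In particular no elliptic modulus has to be followed through
a degeneration: where a range shrinks to a point, `(e, m)` simply tends to a point of the ray
`e = 4 m`.

There are only two kinds of periods. If the range is adjacent to one of the singular points
`ξ = 1`, `η = ±1` only, the period is `separatedPeriod`, which has the same value near the Earth
and near the Moon; if it is `η ∈ (-1, 1)`, or if `ξ` stays away from `1`, the period is
`surroundingPeriod`. Since `f` is `h` with `δ` replaced by `1`, the two formulas serve for both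
coordinates. The rotation numbers of the critical orbits are then limits of quotients of these
functions, and by homogeneity they become

* interior collision: `Φ(√(1 - κ² / (γ - 1)²))`, with `Φ = collisionRatio` decreasing;
* exterior collision: `1 / Φ(√(1 + κ² / (γ ± δ)²))`;
* double collision: `ellInt (4 (κ - w)) (2 κ) / agmInt (4 w) (4 w)` with `w = γ - 1`;
* elliptic: `Ψ(√(1 + 4 κ² / k²))` with `k = 1 / γ - γ` and `Ψ = ellipticRatio` decreasing,

so that the monotonicity and the limits in `c` can be read off. In the remaining cases exactly one
of the two periods diverges, because `e` or `m` tends to `0`.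
-/

namespace EulerProblem

/-! ### The complete elliptic integral -/

/-- The complete elliptic integral `∫₀^∞ 2 dt / √(m (t² - 1)² + e t²)`, the common normal form of
all the periods. The parameters are chosen such that it decreases in each of them and converges
exactly for `e, m > 0`. -/
noncomputable def ellInt (e m : ℝ) : ℝ≥0∞ :=
  ∫⁻ t in Set.Ioi (0 : ℝ), ENNReal.ofReal (2 / √(m * (t ^ 2 - 1) ^ 2 + e * t ^ 2))

attribute [irreducible] ellInt

theorem measurable_ellInt_integrand (e m : ℝ) :
    Measurable fun t : ℝ => ENNReal.ofReal (2 / √(m * (t ^ 2 - 1) ^ 2 + e * t ^ 2)) := by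
  fun_prop

theorem ellInt_integrand_pos {e m t : ℝ} (he : 0 < e) (hm : 0 ≤ m) (ht : 0 < t) :
    0 < m * (t ^ 2 - 1) ^ 2 + e * t ^ 2 := by positivity

theorem ellInt_smul {l : ℝ} (hl : 0 < l) (e m : ℝ) :
    ellInt (l * e) (l * m) = ENNReal.ofReal (1 / √l) * ellInt e m := by
  unfold ellInt
  rw [← lintegral_const_mul _ (measurable_ellInt_integrand e m)]
  refine lintegral_congr fun t => ?_
  rw [← ENNReal.ofReal_mul (by positivity)]
  have : l * m * (t ^ 2 - 1) ^ 2 + l * e * t ^ 2 = l * (m * (t ^ 2 - 1) ^ 2 + e * t ^ 2) := by ring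
  rw [this, Real.sqrt_mul hl.le]
  congr 1
  rw [div_mul_div_comm, one_mul]

theorem ellInt_anti {e e' m m' : ℝ} (he : 0 < e) (hm : 0 < m) (hee : e ≤ e') (hmm : m ≤ m') :
    ellInt e' m' ≤ ellInt e m := by
  unfold ellInt
  refine setLIntegral_mono (measurable_ellInt_integrand e m) fun t ht => ?_
  have ht : 0 < t := ht
  gcongr

theorem ellInt_smul_four_lt_top {k : ℝ} (hk : 0 < k) : ellInt (4 * k) k < ⊤ := by
  have h1 : IntegrableOn (fun t : ℝ => 2 / √k * (1 + t ^ 2)⁻¹) (Set.Ioi 0) :=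
    (integrable_inv_one_add_sq.const_mul _).integrableOn
  refine lt_of_eq_of_lt ?_ h1.lintegral_lt_top
  unfold ellInt
  refine lintegral_congr fun t => ?_
  have : k * (t ^ 2 - 1) ^ 2 + 4 * k * t ^ 2 = k * (1 + t ^ 2) ^ 2 := by ring
  rw [this, Real.sqrt_mul hk.le, Real.sqrt_sq (by positivity), ← div_eq_mul_inv, div_div]

theorem ellInt_lt_top {e m : ℝ} (he : 0 < e) (hm : 0 < m) : ellInt e m < ⊤ := by
  have hk : 0 < min (e / 4) m := by positivity
  refine (ellInt_anti (by positivity) hk ?_ (min_le_right _ _)).trans_lt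
    (ellInt_smul_four_lt_top hk)
  linarith [min_le_left (e / 4) m]

theorem ellInt_pos {e m : ℝ} (he : 0 < e) (hm : 0 < m) : 0 < ellInt e m := by
  unfold ellInt
  rw [setLIntegral_pos_iff (measurable_ellInt_integrand e m)]
  have : Set.Ioi (0 : ℝ) ⊆
      (Function.support fun t : ℝ => ENNReal.ofReal (2 / √(m * (t ^ 2 - 1) ^ 2 + e * t ^ 2))) := by
    intro t ht
    have := ellInt_integrand_pos he hm.le ht
    rw [Function.mem_support, Ne, ENNReal.ofReal_eq_zero, not_le]
    positivity
  rw [Set.inter_eq_self_of_subset_right this]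
  simp

theorem ellInt_strictAnti {e e' m m' : ℝ} (he : 0 < e) (hm : 0 < m) (hee : e < e')
    (hmm : m ≤ m') : ellInt e' m' < ellInt e m := by
  have hfin := (ellInt_lt_top (he.trans hee) (hm.trans_le hmm)).ne
  unfold ellInt at hfin ⊢
  refine setLIntegral_strict_mono measurableSet_Ioi (by simp)
    (measurable_ellInt_integrand e m) hfin (ae_of_all _ fun t ht => ?_)
  have ht : 0 < t := ht
  have := ellInt_integrand_pos he hm.le ht
  rw [ENNReal.ofReal_lt_ofReal_iff (by positivity)]
  refine div_lt_div_of_pos_left two_pos (Real.sqrt_pos.2 this) (Real.sqrt_lt_sqrt this.le ?_)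
  exact add_lt_add_of_le_of_lt (by gcongr) (by gcongr)

theorem ellInt_continuousAt {e m : ℝ} (he : 0 < e) (hm : 0 < m) :
    ContinuousAt (fun p : ℝ × ℝ => ellInt p.1 p.2) (e, m) := by
  have hfin := (ellInt_lt_top (half_pos he) (half_pos hm)).ne
  unfold ellInt at hfin ⊢
  unfold ContinuousAt
  refine tendsto_lintegral_filter_of_dominated_convergence
    (fun t => ENNReal.ofReal (2 / √(m / 2 * (t ^ 2 - 1) ^ 2 + e / 2 * t ^ 2)))
    (Eventually.of_forall fun p => measurable_ellInt_integrand p.1 p.2) ?_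
    hfin ?_
  · have h1 : ∀ᶠ p : ℝ × ℝ in 𝓝 (e, m), e / 2 < p.1 :=
      continuousAt_fst.eventually (lt_mem_nhds (half_lt_self he))
    have h2 : ∀ᶠ p : ℝ × ℝ in 𝓝 (e, m), m / 2 < p.2 :=
      continuousAt_snd.eventually (lt_mem_nhds (half_lt_self hm))
    filter_upwards [h1, h2] with p hp1 hp2
    refine (ae_restrict_iff' measurableSet_Ioi).2 (ae_of_all _ fun t ht => ?_)
    have ht : 0 < t := ht
    gcongr
  · refine (ae_restrict_iff' measurableSet_Ioi).2 (ae_of_all _ fun t ht => ?_)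
    have := ellInt_integrand_pos he hm.le ht
    refine (ENNReal.continuous_ofReal.tendsto _).comp ?_
    have h3 : ContinuousAt (fun p : ℝ × ℝ => 2 / √(p.2 * (t ^ 2 - 1) ^ 2 + p.1 * t ^ 2)) (e, m) := by
      refine ContinuousAt.div (by fun_prop) (by fun_prop) ?_
      positivity
    exact h3

theorem tendsto_ellInt {α : Type*} {l : Filter α} {u v : α → ℝ} {e m : ℝ} (he : 0 < e)
    (hm : 0 < m) (hu : Tendsto u l (𝓝 e)) (hv : Tendsto v l (𝓝 m)) :
    Tendsto (fun x => ellInt (u x) (v x)) l (𝓝 (ellInt e m)) := by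
  have h1 : Tendsto (fun p : ℝ × ℝ => ellInt p.1 p.2) (𝓝 (e, m)) (𝓝 (ellInt e m)) :=
    ellInt_continuousAt he hm
  exact h1.comp (hu.prodMk_nhds hv)

theorem lintegral_inv_sub {a b s : ℝ} (hs : s < a) (hab : a ≤ b) :
    ∫⁻ t in Set.Ioc a b, ENNReal.ofReal (1 / (t - s)) =
      ENNReal.ofReal (Real.log ((b - s) / (a - s))) := by
  have h1 : ∫ t in a..b, 1 / (t - s) = Real.log ((b - s) / (a - s)) := by
    have h2 := intervalIntegral.integral_comp_sub_right (a := a) (b := b) (fun x : ℝ => 1 / x) s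
    have h3 : ∫ x in (a - s)..(b - s), 1 / x = Real.log ((b - s) / (a - s)) :=
      integral_one_div_of_pos (by linarith) (by linarith)
    exact h2.trans h3
  rw [← h1, intervalIntegral.integral_of_le hab]
  refine (ofReal_integral_eq_lintegral_ofReal ?_ ?_).symm
  · refine (intervalIntegrable_iff_integrableOn_Ioc_of_le hab).1 ?_
    refine ContinuousOn.intervalIntegrable fun t ht => ?_
    rw [Set.uIcc_of_le hab] at ht
    have : t - s ≠ 0 := by linarith [ht.1]
    exact ContinuousAt.continuousWithinAt (by fun_prop (disch := assumption))
  · refine (ae_restrict_iff' measurableSet_Ioc).2 (ae_of_all _ fun t ht => ?_)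
    have : 0 < t - s := by linarith [ht.1]
    simp only [Pi.zero_apply]
    positivity

/-- The logarithmic divergence of `ellInt e m` as `e → 0`, from the part `t ∈ (1 + √e, 2]`. -/
theorem log_le_ellInt_of_left {e m : ℝ} (he : 0 < e) (he' : e ≤ 1) (hm : 0 < m) :
    ENNReal.ofReal (2 / √(9 * m + 4)) * ENNReal.ofReal (Real.log (1 / √e)) ≤ ellInt e m := by
  have hs : 0 < √e := Real.sqrt_pos.2 he
  have hs1 : √e ≤ 1 := Real.sqrt_le_one.2 he'
  have h1 := lintegral_inv_sub (a := 1 + √e) (b := 2) (s := 1) (by linarith) (by linarith)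
  rw [show (2 - 1 : ℝ) / (1 + √e - 1) = 1 / √e by norm_num] at h1
  rw [← h1, ← lintegral_const_mul _ (by fun_prop)]
  unfold ellInt
  refine (setLIntegral_mono (measurable_ellInt_integrand e m) fun t ht => ?_).trans
    (lintegral_mono_set (fun t ht => ?_))
  · have h2 : √e ≤ t - 1 := by linarith [ht.1]
    have h3 : e ≤ (t - 1) ^ 2 := by
      rw [← Real.sq_sqrt he.le]; gcongr
    have h4 : 0 < t - 1 := by linarith
    have ht0 : 0 < t := by linarith
    have ht2 : t ≤ 2 := ht.2
    rw [← ENNReal.ofReal_mul (by positivity), div_mul_div_comm, mul_one]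
    have h5 : m * (t ^ 2 - 1) ^ 2 + e * t ^ 2 ≤ (9 * m + 4) * (t - 1) ^ 2 := by
      have h6 : (t + 1) ^ 2 ≤ 9 := by nlinarith
      have h7 : t ^ 2 ≤ 4 := by nlinarith
      calc m * (t ^ 2 - 1) ^ 2 + e * t ^ 2
          = m * (t + 1) ^ 2 * (t - 1) ^ 2 + t ^ 2 * e := by ring
        _ ≤ m * 9 * (t - 1) ^ 2 + 4 * (t - 1) ^ 2 := by gcongr
        _ = _ := by ring
    have h8 : √(9 * m + 4) * (t - 1) = √((9 * m + 4) * (t - 1) ^ 2) := by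
      rw [Real.sqrt_mul (by positivity), Real.sqrt_sq h4.le]
    rw [h8]
    have := ellInt_integrand_pos he hm.le ht0
    gcongr
  · have : 0 < t := by linarith [ht.1]
    exact this

/-- The logarithmic divergence of `ellInt e m` as `m → 0`, from the part `t ∈ (1, 1 / √m]`. -/
theorem log_le_ellInt_of_right {e m : ℝ} (he : 0 < e) (hm : 0 < m) (hm' : m ≤ 1) :
    ENNReal.ofReal (2 / √(1 + e)) * ENNReal.ofReal (Real.log (1 / √m)) ≤ ellInt e m := by
  have hs : 0 < √m := Real.sqrt_pos.2 hm
  have hs1 : √m ≤ 1 := Real.sqrt_le_one.2 hm'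
  have h1 := lintegral_inv_sub (a := 1) (b := 1 / √m) (s := 0) (by norm_num)
    (by rw [le_div_iff₀ hs]; linarith)
  simp only [sub_zero, div_one] at h1
  rw [← h1, ← lintegral_const_mul _ (by fun_prop)]
  unfold ellInt
  refine (setLIntegral_mono (measurable_ellInt_integrand e m) fun t ht => ?_).trans
    (lintegral_mono_set (fun t ht => ?_))
  · have ht1 : 1 < t := ht.1
    have ht0 : 0 < t := by linarith
    have h2 : t * √m ≤ 1 := by rw [← le_div_iff₀ hs]; exact ht.2
    have h3 : m * t ^ 2 ≤ 1 := by
      calc m * t ^ 2 = (t * √m) ^ 2 := by rw [mul_pow, Real.sq_sqrt hm.le]; ring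
        _ ≤ 1 := pow_le_one₀ (by positivity) h2
    rw [← ENNReal.ofReal_mul (by positivity), div_mul_div_comm, mul_one]
    have h5 : m * (t ^ 2 - 1) ^ 2 + e * t ^ 2 ≤ (1 + e) * t ^ 2 := by
      have h6 : (t ^ 2 - 1) ^ 2 ≤ (t ^ 2) ^ 2 := by
        have : 0 ≤ t ^ 2 - 1 := by nlinarith
        gcongr; linarith
      calc m * (t ^ 2 - 1) ^ 2 + e * t ^ 2
          ≤ m * (t ^ 2) ^ 2 + e * t ^ 2 := by gcongr
        _ = (m * t ^ 2) * t ^ 2 + e * t ^ 2 := by ring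
        _ ≤ 1 * t ^ 2 + e * t ^ 2 := by gcongr
        _ = _ := by ring
    have h8 : √(1 + e) * t = √((1 + e) * t ^ 2) := by
      rw [Real.sqrt_mul (by positivity), Real.sqrt_sq ht0.le]
    rw [h8]
    have := ellInt_integrand_pos he hm.le ht0
    gcongr
  · have : 0 < t := by linarith [ht.1]
    exact this

theorem tendsto_log_one_div_sqrt :
    Tendsto (fun x : ℝ => ENNReal.ofReal (Real.log (1 / √x))) (𝓝[>] 0) (𝓝 ⊤) := by
  refine ENNReal.tendsto_ofReal_nhds_top.2 (Real.tendsto_log_atTop.comp ?_)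
  have h1 : Tendsto (fun x : ℝ => √x) (𝓝[>] 0) (𝓝[>] 0) := by
    refine tendsto_nhdsWithin_iff.2 ⟨?_, ?_⟩
    · have := (Real.continuous_sqrt.tendsto 0).mono_left (nhdsWithin_le_nhds (s := Set.Ioi 0))
      simpa using this
    · filter_upwards [self_mem_nhdsWithin] with x hx
      exact Real.sqrt_pos.2 hx
  simp only [one_div]
  exact tendsto_inv_nhdsGT_zero.comp h1

theorem tendsto_ellInt_top_of_left {α : Type*} {l : Filter α} {u v : α → ℝ} {m : ℝ}
    (hu : Tendsto u l (𝓝[>] 0)) (hv : Tendsto v l (𝓝 m)) (hv0 : ∀ᶠ x in l, 0 < v x) :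
    Tendsto (fun x => ellInt (u x) (v x)) l (𝓝 ⊤) := by
  rw [tendsto_nhdsWithin_iff] at hu
  obtain ⟨hu, hu0⟩ := hu
  have hM : 0 < |m| + 1 := by positivity
  have h1 : Tendsto (fun x => ENNReal.ofReal (2 / √(9 * (|m| + 1) + 4)) *
      ENNReal.ofReal (Real.log (1 / √(u x)))) l (𝓝 ⊤) := by
    have := ENNReal.Tendsto.const_mul (a := ENNReal.ofReal (2 / √(9 * (|m| + 1) + 4)))
      (tendsto_log_one_div_sqrt.comp (tendsto_nhdsWithin_iff.2 ⟨hu, hu0⟩)) (Or.inl (by simp))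
    rwa [ENNReal.mul_top (by simp; positivity)] at this
  refine tendsto_of_tendsto_of_tendsto_of_le_of_le' h1 tendsto_const_nhds ?_ (by simp)
  filter_upwards [hu0, hv0, hu.eventually (gt_mem_nhds zero_lt_one),
    hv.eventually (gt_mem_nhds (show m < |m| + 1 by linarith [le_abs_self m]))] with x h2 h3 h4 h5
  exact (log_le_ellInt_of_left h2 h4.le hM).trans (ellInt_anti h2 h3 le_rfl h5.le)

theorem tendsto_ellInt_top_of_right {α : Type*} {l : Filter α} {u v : α → ℝ} {e : ℝ}
    (hu : Tendsto u l (𝓝 e)) (hv : Tendsto v l (𝓝[>] 0)) (hu0 : ∀ᶠ x in l, 0 < u x) :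
    Tendsto (fun x => ellInt (u x) (v x)) l (𝓝 ⊤) := by
  rw [tendsto_nhdsWithin_iff] at hv
  obtain ⟨hv, hv0⟩ := hv
  have hM : 0 < |e| + 1 := by positivity
  have h1 : Tendsto (fun x => ENNReal.ofReal (2 / √(1 + (|e| + 1))) *
      ENNReal.ofReal (Real.log (1 / √(v x)))) l (𝓝 ⊤) := by
    have := ENNReal.Tendsto.const_mul (a := ENNReal.ofReal (2 / √(1 + (|e| + 1))))
      (tendsto_log_one_div_sqrt.comp (tendsto_nhdsWithin_iff.2 ⟨hv, hv0⟩)) (Or.inl (by simp))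
    rwa [ENNReal.mul_top (by simp; positivity)] at this
  refine tendsto_of_tendsto_of_tendsto_of_le_of_le' h1 tendsto_const_nhds ?_ (by simp)
  filter_upwards [hv0, hu0, hv.eventually (gt_mem_nhds zero_lt_one),
    hu.eventually (gt_mem_nhds (show e < |e| + 1 by linarith [le_abs_self e]))] with x h2 h3 h4 h5
  exact (log_le_ellInt_of_right hM h2 h4.le).trans (ellInt_anti h3 h2 h5.le le_rfl)

theorem tendsto_ellInt_zero {α : Type*} {l : Filter α} {u v : α → ℝ}
    (hu : Tendsto u l atTop) (hv : Tendsto v l atTop) :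
    Tendsto (fun x => ellInt (u x) (v x)) l (𝓝 0) := by
  have hk : Tendsto (fun x => min (u x / 4) (v x)) l atTop :=
    tendsto_atTop.2 fun b => by
      filter_upwards [tendsto_atTop.1 hu (4 * b), tendsto_atTop.1 hv b] with x h1 h2
      exact le_min (by linarith) h2
  have h1 : Tendsto (fun x => ENNReal.ofReal (1 / √(min (u x / 4) (v x))) * ellInt 4 1) l
      (𝓝 0) := by
    have h2 : Tendsto (fun x => 1 / √(min (u x / 4) (v x))) l (𝓝 0) := by
      simp only [one_div]
      exact tendsto_inv_atTop_zero.comp (Real.tendsto_sqrt_atTop.comp hk)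
    have h3 := ENNReal.Tendsto.mul_const (b := ellInt 4 1) (ENNReal.tendsto_ofReal h2)
      (Or.inr (ellInt_lt_top (by norm_num) (by norm_num)).ne)
    simpa using h3
  refine tendsto_of_tendsto_of_tendsto_of_le_of_le' tendsto_const_nhds h1 (by simp) ?_
  filter_upwards [hk.eventually_gt_atTop 0] with x hx
  rw [← ellInt_smul hx, mul_one]
  exact ellInt_anti (by positivity) hx (by linarith [min_le_left (u x / 4) (v x)])
    (min_le_right _ _)

/-- A period of a quartic whose roots `a < b` bound an interval of positivity, in normal form.
Here `m² = q(a) q(b)`, and `e - 2 m` is twice the polar form of `q` at `(a, b)`. -/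
theorem lintegral_quartic {F : ℝ → ℝ} {a b A B C e m : ℝ} (hab : a < b)
    (hF : ∀ x, a < x → x < b → F x = (x - a) * (b - x) * (A * x ^ 2 + B * x + C))
    (ha : 0 < A * a ^ 2 + B * a + C) (hb : 0 < A * b ^ 2 + B * b + C) (hm : 0 ≤ m)
    (hm2 : m ^ 2 = (A * a ^ 2 + B * a + C) * (A * b ^ 2 + B * b + C))
    (he : e = 2 * A * a * b + B * (a + b) + 2 * C + 2 * m) :
    ∫⁻ x in Set.Ioo a b, ENNReal.ofReal (1 / √(F x)) = ellInt e m := by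
  set qa := A * a ^ 2 + B * a + C with hqa
  set qb := A * b ^ 2 + B * b + C with hqb
  have hm : 0 < m := by
    rcases hm.eq_or_lt with h0 | h0
    · rw [← h0] at hm2
      nlinarith [mul_pos ha hb]
    · exact h0
  -- The dilation of `t²` that balances the coefficients `q(a)` of `1` and `q(b)` of `t⁴`.
  obtain ⟨l, hl, hl1, hl2⟩ : ∃ l : ℝ, 0 < l ∧ qa = l * m ∧ qb * l = m := by
    refine ⟨m / qb, by positivity, ?_, by field_simp⟩
    field_simp
    linarith
  have hpos : ∀ t : ℝ, 0 < 1 + l * t ^ 2 := fun t => by positivity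
  let φ : ℝ → ℝ := fun t => b - (b - a) / (1 + l * t ^ 2)
  have him : φ '' Set.Ioi 0 = Set.Ioo a b := by
    ext x
    constructor
    · rintro ⟨t, ht, rfl⟩
      have ht : 0 < t := ht
      have h1 : 0 < (b - a) / (1 + l * t ^ 2) := div_pos (by linarith) (hpos t)
      have h2 : (b - a) / (1 + l * t ^ 2) < b - a := by
        rw [div_lt_iff₀ (hpos t)]
        nlinarith [mul_pos (sub_pos.2 hab) (mul_pos hl (pow_pos ht 2))]
      simp only [φ, Set.mem_Ioo]
      constructor <;> linarith
    · rintro ⟨hx1, hx2⟩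
      have h1 : 0 < (x - a) / (l * (b - x)) :=
        div_pos (by linarith) (mul_pos hl (by linarith))
      refine ⟨√((x - a) / (l * (b - x))), Real.sqrt_pos.2 h1, ?_⟩
      simp only [φ]
      rw [Real.sq_sqrt h1.le]
      have h3 : b - x ≠ 0 := by linarith
      have h4 : b - a ≠ 0 := by linarith
      have : 1 + l * ((x - a) / (l * (b - x))) = (b - a) / (b - x) := by
        field_simp
        ring
      rw [this]
      field_simp
      ring
  have hderiv : ∀ t ∈ Set.Ioi (0 : ℝ), HasDerivWithinAt φ
      ((b - a) * (2 * l * t) / (1 + l * t ^ 2) ^ 2) (Set.Ioi 0) t := by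
    intro t _
    have h1 : HasDerivAt (fun t : ℝ => 1 + l * t ^ 2) (2 * l * t) t := by
      have := ((hasDerivAt_pow 2 t).const_mul l).const_add 1
      refine this.congr_deriv ?_
      norm_num
      ring
    have h2 := ((hasDerivAt_const t (b - a)).div h1 (hpos t).ne').const_sub b
    refine (h2.congr_deriv ?_).hasDerivWithinAt
    ring
  have hinj : Set.InjOn φ (Set.Ioi 0) := by
    intro s hs t ht hst
    have hs : 0 < s := hs
    have ht : 0 < t := ht
    simp only [φ, sub_right_inj] at hst
    rw [div_eq_div_iff (hpos s).ne' (hpos t).ne'] at hst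
    have h1 := mul_left_cancel₀ (sub_pos.2 hab).ne' hst
    have h2 : t ^ 2 = s ^ 2 := mul_left_cancel₀ hl.ne' (by linarith)
    exact ((pow_left_inj₀ ht.le hs.le two_ne_zero).1 h2).symm
  rw [← him, lintegral_image_eq_lintegral_abs_deriv_mul measurableSet_Ioi hderiv hinj]
  unfold ellInt
  refine setLIntegral_congr_fun measurableSet_Ioi fun t ht => ?_
  have hmem : φ t ∈ Set.Ioo a b := him ▸ Set.mem_image_of_mem φ ht
  have ht : 0 < t := ht
  have hba : 0 < b - a := sub_pos.2 hab
  rw [hF _ hmem.1 hmem.2, abs_of_pos (by have := hpos t; positivity),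
    ← ENNReal.ofReal_mul (by have := hpos t; positivity)]
  congr 1
  have hp := hpos t
  have h5 : (φ t - a) * (b - φ t) * (A * φ t ^ 2 + B * φ t + C) =
      ((b - a) * (l * t) / (1 + l * t ^ 2) ^ 2) ^ 2 * (m * (t ^ 2 - 1) ^ 2 + e * t ^ 2) := by
    simp only [φ]
    have e1 : b - (b - a) / (1 + l * t ^ 2) - a = (b - a) * (l * t ^ 2) / (1 + l * t ^ 2) := by
      field_simp; ring
    have e2 : b - (b - (b - a) / (1 + l * t ^ 2)) = (b - a) / (1 + l * t ^ 2) := by ring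
    have e4 : b - (b - a) / (1 + l * t ^ 2) = (a + b * (l * t ^ 2)) / (1 + l * t ^ 2) := by
      field_simp; ring
    have e3 : A * (b - (b - a) / (1 + l * t ^ 2)) ^ 2 + B * (b - (b - a) / (1 + l * t ^ 2)) + C =
        l * (m * (t ^ 2 - 1) ^ 2 + e * t ^ 2) / (1 + l * t ^ 2) ^ 2 := by
      rw [e4, eq_div_iff (by positivity)]
      field_simp
      rw [hqa] at hl1
      rw [hqb] at hl2
      linear_combination hl1 - l * t ^ 2 * he + l * t ^ 4 * hl2
    rw [e3, e1, e2]
    field_simp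
  rw [h5, Real.sqrt_mul (by positivity), Real.sqrt_sq (by positivity)]
  field_simp

/-- The integral `π / AGM(√P, √Q)`, i.e. `∫ 2 dφ / √(P cos² φ + Q sin² φ)` over `[0, π/2]`, after
one step of the arithmetic-geometric mean. -/
noncomputable def agmInt (P Q : ℝ) : ℝ≥0∞ := ellInt ((√P + √Q) ^ 2) (√(P * Q))

theorem agmInt_comm (P Q : ℝ) : agmInt P Q = agmInt Q P := by
  unfold agmInt
  rw [add_comm, mul_comm]

theorem agmInt_eq {P Q m : ℝ} (hP : 0 ≤ P) (hQ : 0 ≤ Q) (hm : m = √(P * Q)) :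
    agmInt P Q = ellInt (P + Q + 2 * m) m := by
  unfold agmInt
  rw [add_sq, Real.sq_sqrt hP, Real.sq_sqrt hQ, mul_assoc, ← Real.sqrt_mul hP, ← hm]
  congr 1
  ring

theorem agmInt_smul {l P Q : ℝ} (hl : 0 < l) (hP : 0 ≤ P) (hQ : 0 ≤ Q) :
    agmInt (l * P) (l * Q) = ENNReal.ofReal (1 / √l) * agmInt P Q := by
  have h1 : l * √(P * Q) = √(l * P * (l * Q)) := by
    rw [show l * P * (l * Q) = l ^ 2 * (P * Q) by ring, Real.sqrt_mul (sq_nonneg l) (P * Q),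
      Real.sqrt_sq hl.le]
  rw [agmInt_eq (by positivity) (by positivity) h1, agmInt_eq hP hQ rfl, ← ellInt_smul hl]
  congr 1
  ring

theorem agmInt_lt_top {P Q : ℝ} (hP : 0 < P) (hQ : 0 < Q) : agmInt P Q < ⊤ :=
  ellInt_lt_top (by positivity) (by positivity)

theorem agmInt_pos {P Q : ℝ} (hP : 0 < P) (hQ : 0 < Q) : 0 < agmInt P Q :=
  ellInt_pos (by positivity) (by positivity)

theorem agmInt_strictAnti {P P' Q Q' : ℝ} (hP : 0 < P) (hQ : 0 < Q) (hPP : P < P')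
    (hQQ : Q ≤ Q') : agmInt P' Q' < agmInt P Q := by
  have h1 : √P < √P' := Real.sqrt_lt_sqrt hP.le hPP
  have h2 : √Q ≤ √Q' := Real.sqrt_le_sqrt hQQ
  have h3 : P * Q ≤ P' * Q' := mul_le_mul hPP.le hQQ hQ.le (hP.trans hPP).le
  unfold agmInt
  exact ellInt_strictAnti (by positivity) (by positivity)
    (pow_lt_pow_left₀ (by linarith) (by positivity) two_ne_zero) (Real.sqrt_le_sqrt h3)

section
variable {α : Type*} {l : Filter α} {u v : α → ℝ}

theorem tendsto_agmInt {P Q : ℝ} (hP : 0 < P) (hQ : 0 < Q) (hu : Tendsto u l (𝓝 P))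
    (hv : Tendsto v l (𝓝 Q)) : Tendsto (fun x => agmInt (u x) (v x)) l (𝓝 (agmInt P Q)) :=
  tendsto_ellInt (by positivity) (by positivity) ((hu.sqrt.add hv.sqrt).pow 2) (hu.mul hv).sqrt

theorem tendsto_agmInt_top {Q : ℝ} (hQ : 0 < Q) (hu : Tendsto u l (𝓝[>] 0))
    (hv : Tendsto v l (𝓝 Q)) : Tendsto (fun x => agmInt (u x) (v x)) l (𝓝 ⊤) := by
  rw [tendsto_nhdsWithin_iff] at hu
  have hv0 := hv.eventually (lt_mem_nhds hQ)
  refine tendsto_ellInt_top_of_right (e := (√0 + √Q) ^ 2) ((hu.1.sqrt.add hv.sqrt).pow 2)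
    (tendsto_nhdsWithin_iff.2 ⟨?_, ?_⟩) ?_
  · simpa using (hu.1.mul hv).sqrt
  · filter_upwards [hu.2, hv0] with x h1 h2
    exact Real.sqrt_pos.2 (mul_pos h1 h2)
  · filter_upwards [hu.2, hv0] with x h1 h2
    have := Real.sqrt_pos.2 h2
    positivity

theorem tendsto_agmInt_zero (hu : Tendsto u l atTop) (hv : Tendsto v l atTop) :
    Tendsto (fun x => agmInt (u x) (v x)) l (𝓝 0) := by
  refine tendsto_ellInt_zero ?_ (Real.tendsto_sqrt_atTop.comp (hu.atTop_mul_atTop₀ hv))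
  exact (tendsto_pow_atTop two_ne_zero).comp
    ((Real.tendsto_sqrt_atTop.comp hu).atTop_add_atTop (Real.tendsto_sqrt_atTop.comp hv))

end

/-! ### The ranges and the periods -/

/-- The period, multiplied by `√2`, of a coordinate whose range is adjacent to one endpoint only: the `η`-period of the
motions around one primary and, for `del = 1`, the `ξ`-period of the motions reaching `ξ = 1`. -/
noncomputable def separatedPeriod (del gam g : ℝ) : ℝ≥0∞ :=
  agmInt (4 * √(del ^ 2 + gam * g)) (gam + g + 2 * √(del ^ 2 + gam * g))

/-- The `η`-period, multiplied by `√2`, of the motions surrounding both primaries and, for `del = 1`, the `ξ`-period of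
the motions that do not reach `ξ = 1`. -/
noncomputable def surroundingPeriod (del gam g : ℝ) : ℝ≥0∞ :=
  ellInt (2 * (√((gam - g) ^ 2 - 4 * del ^ 2) - gam - g)) √((gam - g) ^ 2 - 4 * del ^ 2)

theorem separatedPeriod_eq {del gam g D : ℝ} (hD : 0 ≤ D) (hD2 : D ^ 2 = del ^ 2 + gam * g) :
    separatedPeriod del gam g = agmInt (4 * D) (gam + g + 2 * D) := by
  rw [separatedPeriod, ← hD2, Real.sqrt_sq hD]

theorem surroundingPeriod_eq {del gam g m : ℝ} (hm : 0 ≤ m)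
    (hm2 : m ^ 2 = (gam - g) ^ 2 - 4 * del ^ 2) :
    surroundingPeriod del gam g = ellInt (2 * (m - gam - g)) m := by
  rw [surroundingPeriod, ← hm2, Real.sqrt_sq hm]

theorem rotation_eq (k : Primary) (μ g c : ℝ) :
    rotation k μ g c = (∫⁻ η in etaRange μ g c k, ENNReal.ofReal (1 / √(h μ g c η))) /
      ∫⁻ ξ in xiRange g c, ENNReal.ofReal (1 / √(f g c ξ)) := by
  unfold rotation tauEta tauXi
  exact ENNReal.mul_div_mul_left _ _ (by simp) (by simp)

/-- For `g > γ - 2` the `ξ`-range is `(1, ξ₂)` with `ξ₂` the larger root of `-γ ξ² + 2 ξ + g`. -/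
theorem xiRange_separated_of_sq {gam g D : ℝ} (hgam : 0 < gam) (hD : 0 < D)
    (hD2 : D ^ 2 = 1 + gam * g) (hg : gam - 2 < g) :
    (xiRange g (-gam)).Nonempty ∧
      ∫⁻ ξ in xiRange g (-gam), ENNReal.ofReal (1 / √(f g (-gam) ξ)) =
        agmInt (4 * D) (gam + g + 2 * D) := by
  have hlt : |gam - 1| < D := abs_lt_of_sq_lt_sq (by nlinarith) hD.le
  obtain ⟨h1, h2⟩ := abs_lt.1 hlt
  have hg' : g = (D ^ 2 - 1) / gam := by field_simp; linarith
  obtain ⟨r1, hr1⟩ : ∃ r1, r1 = (1 - D) / gam := ⟨_, rfl⟩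
  obtain ⟨r2, hr2⟩ : ∃ r2, r2 = (1 + D) / gam := ⟨_, rfl⟩
  have hr1' : r1 < 1 := by rw [hr1, div_lt_one hgam]; linarith
  have hr2' : 1 < r2 := by rw [hr2, one_lt_div hgam]; linarith
  have hfac : ∀ x, f g (-gam) x = (x - 1) * (r2 - x) * (gam * (x - r1) * (x + 1)) := by
    intro x
    rw [hg', hr1, hr2]
    unfold f
    field_simp
    ring
  have hrange : xiRange g (-gam) = Set.Ioo 1 r2 := by
    ext x
    simp only [xiRange, Set.mem_ofPred_eq, Set.mem_Ioo, hfac]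
    refine and_congr_right fun hx => ?_
    have h3 : 0 < gam * (x - r1) * (x + 1) :=
      mul_pos (mul_pos hgam (by linarith)) (by linarith)
    rw [mul_pos_iff_of_pos_right h3, mul_pos_iff_of_pos_left (by linarith), sub_pos]
  refine ⟨hrange ▸ Set.nonempty_Ioo.2 hr2', ?_⟩
  have hQ : gam + g + 2 * D = gam * (r2 + 1) * (1 - r1) := by
    rw [hg', hr1, hr2]; field_simp; ring
  have hQ0 : 0 < gam + g + 2 * D := by
    rw [hQ]
    exact mul_pos (mul_pos hgam (by linarith)) (by linarith)
  rw [hrange, agmInt_eq (by positivity) hQ0.le rfl]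
  refine lintegral_quartic (A := gam) (B := gam * (1 - r1)) (C := -(gam * r1)) hr2'
    (fun x _ _ => by rw [hfac]; ring) ?_ ?_ (Real.sqrt_nonneg _) ?_ ?_
  · have : 0 < gam * (1 - r1) := mul_pos hgam (by linarith)
    linarith
  · have : 0 < gam * (r2 - r1) * (r2 + 1) := mul_pos (mul_pos hgam (by linarith)) (by linarith)
    linarith
  · rw [Real.sq_sqrt (by positivity), hg', hr1, hr2]
    field_simp
    ring
  · generalize √(4 * D * (gam + g + 2 * D)) = m
    rw [hg', hr1, hr2]
    field_simp
    ring

/-- Here the `ξ`-range lies between the two roots of `-γ ξ² + 2 ξ + g`, both larger than `1`. -/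
theorem xiRange_surrounding {gam g : ℝ} (hgam : 0 < gam) (hgam' : gam < 1)
    (hg : -1 < gam * g) (hg' : g < gam - 2) :
    (xiRange g (-gam)).Nonempty ∧
      ∫⁻ ξ in xiRange g (-gam), ENNReal.ofReal (1 / √(f g (-gam) ξ)) =
        surroundingPeriod 1 gam g := by
  obtain ⟨D, hD, hD2⟩ : ∃ D, 0 < D ∧ D ^ 2 = 1 + gam * g :=
    ⟨√(1 + gam * g), Real.sqrt_pos.2 (by linarith), Real.sq_sqrt (by linarith)⟩
  have hlt : D < 1 - gam := lt_of_pow_lt_pow_left₀ 2 (by linarith) (by nlinarith)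
  have hgD : g = (D ^ 2 - 1) / gam := by field_simp; linarith
  obtain ⟨r1, hr1⟩ : ∃ r1, r1 = (1 - D) / gam := ⟨_, rfl⟩
  obtain ⟨r2, hr2⟩ : ∃ r2, r2 = (1 + D) / gam := ⟨_, rfl⟩
  have hr1' : 1 < r1 := by rw [hr1, one_lt_div hgam]; linarith
  have hr12 : r1 < r2 := by rw [hr1, hr2, div_lt_div_iff_of_pos_right hgam]; linarith
  have hfac : ∀ x, f g (-gam) x = (x - r1) * (r2 - x) * (gam * (x ^ 2 - 1)) := by
    intro x
    rw [hgD, hr1, hr2]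
    unfold f
    field_simp
    ring
  have hrange : xiRange g (-gam) = Set.Ioo r1 r2 := by
    ext x
    simp only [xiRange, Set.mem_ofPred_eq, Set.mem_Ioo, hfac]
    constructor
    · rintro ⟨hx, hx2⟩
      have h3 : 0 < gam * (x ^ 2 - 1) := mul_pos hgam (by nlinarith)
      rw [mul_pos_iff_of_pos_right h3, mul_pos_iff] at hx2
      rcases hx2 with h4 | h4
      · exact ⟨by linarith, by linarith⟩
      · linarith
    · rintro ⟨hx, hx2⟩
      refine ⟨by linarith, mul_pos (mul_pos (by linarith) (by linarith))
        (mul_pos hgam (by nlinarith))⟩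
  refine ⟨hrange ▸ Set.nonempty_Ioo.2 hr12, ?_⟩
  rw [hrange, surroundingPeriod, one_pow, mul_one]
  refine lintegral_quartic (A := gam) (B := 0) (C := -gam) hr12
    (fun x _ _ => by rw [hfac]; ring) ?_ ?_ (Real.sqrt_nonneg _) ?_ ?_
  · have : 0 < gam * (r1 ^ 2 - 1) := mul_pos hgam (by nlinarith)
    linarith
  · have : 0 < gam * (r2 ^ 2 - 1) := mul_pos hgam (by nlinarith)
    linarith
  · rw [Real.sq_sqrt (by nlinarith), hgD, hr1, hr2]
    field_simp
    ring
  · generalize √((gam - g) ^ 2 - 4) = m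
    rw [hgD, hr1, hr2]
    field_simp
    ring

theorem xiRange_eq_empty {gam g : ℝ} (hgam : 1 ≤ gam) (hg : g ≤ gam - 2) :
    xiRange g (-gam) = ∅ := by
  refine Set.eq_empty_of_forall_notMem fun x hx => ?_
  obtain ⟨hx1, hx2⟩ := hx
  unfold f at hx2
  rw [mul_pos_iff_of_pos_right (by nlinarith)] at hx2
  nlinarith [mul_pos (sub_pos.2 hx1) (sub_pos.2 hx1)]

/-- The quadratic factor of `f` has no real root, or a double one. -/
theorem xiRange_eq_empty' {gam g : ℝ} (hgam : 0 < gam) (hg : gam * g ≤ -1) :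
    xiRange g (-gam) = ∅ := by
  refine Set.eq_empty_of_forall_notMem fun x hx => ?_
  obtain ⟨hx1, hx2⟩ := hx
  unfold f at hx2
  rw [mul_pos_iff_of_pos_right (by nlinarith)] at hx2
  nlinarith [mul_pos hgam hx2, sq_nonneg (gam * x - 1)]

theorem h_eq {μ del : ℝ} (hdel : 1 - 2 * μ = del) (gam g x : ℝ) :
    h μ g (-gam) x = (gam * x ^ 2 - 2 * del * x - g) * (1 - x ^ 2) := by
  unfold h
  rw [hdel]
  ring

section
variable {μ del gam g : ℝ}

/-- Behind the Earth the `η`-range is `(-1, η₁)` with `η₁` the smaller root of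
`γ η² - 2 δ η - g`. -/
theorem etaRange_earth_of_sq {D : ℝ} (hdel : 1 - 2 * μ = del) (hgam : 0 < gam) (hD : 0 < D)
    (hD2 : D ^ 2 = del ^ 2 + gam * g) (h1 : D < gam + del) (h2 : del - D < gam) :
    (etaRange μ g (-gam) .earth).Nonempty ∧
      ∫⁻ η in etaRange μ g (-gam) .earth, ENNReal.ofReal (1 / √(h μ g (-gam) η)) =
        agmInt (4 * D) (gam + g + 2 * D) := by
  have hg' : g = (D ^ 2 - del ^ 2) / gam := by field_simp; linarith
  obtain ⟨r1, hr1⟩ : ∃ r1, r1 = (del - D) / gam := ⟨_, rfl⟩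
  obtain ⟨r2, hr2⟩ : ∃ r2, r2 = (del + D) / gam := ⟨_, rfl⟩
  have hr1' : r1 < 1 := by rw [hr1, div_lt_one hgam]; linarith
  have hr1'' : -1 < r1 := by rw [hr1, lt_div_iff₀ hgam]; linarith
  have hr12 : r1 < r2 := by rw [hr1, hr2, div_lt_div_iff_of_pos_right hgam]; linarith
  have hfac : ∀ x, h μ g (-gam) x = (x + 1) * (r1 - x) * (gam * (r2 - x) * (1 - x)) := by
    intro x
    rw [h_eq hdel, hg', hr1, hr2]
    field_simp
    ring
  have hrange : etaRange μ g (-gam) .earth = Set.Ioo (-1) r1 := by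
    ext x
    simp only [etaRange, Set.mem_ofPred_eq, Set.mem_Ioo]
    refine and_congr_right fun hx => ⟨fun hx2 => ?_, fun hx2 => ⟨by linarith, fun t ht htx => ?_⟩⟩
    · by_contra! hx3
      have := hx2.2 r1 hr1'' hx3
      rw [hfac] at this
      simp at this
    · rw [hfac]
      exact mul_pos (mul_pos (by linarith) (by linarith))
        (mul_pos (mul_pos hgam (by linarith)) (by linarith))
  refine ⟨hrange ▸ Set.nonempty_Ioo.2 hr1'', ?_⟩
  have hQ : gam + g + 2 * D = gam * (r2 + 1) * (1 - r1) := by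
    rw [hg', hr1, hr2]; field_simp; ring
  have hQ0 : 0 < gam + g + 2 * D := by
    rw [hQ]
    exact mul_pos (mul_pos hgam (by linarith)) (by linarith)
  rw [hrange, agmInt_eq (by positivity) hQ0.le rfl]
  refine lintegral_quartic (A := gam) (B := -(gam * (1 + r2))) (C := gam * r2) hr1''
    (fun x _ _ => by rw [hfac]; ring) ?_ ?_ (Real.sqrt_nonneg _) ?_ ?_
  · have : 0 < gam * (1 + r2) := mul_pos hgam (by linarith)
    linarith
  · have : 0 < gam * (r2 - r1) * (1 - r1) := mul_pos (mul_pos hgam (by linarith)) (by linarith)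
    linarith
  · rw [Real.sq_sqrt (by positivity), hg', hr1, hr2]
    field_simp
    ring
  · generalize √(4 * D * (gam + g + 2 * D)) = m
    rw [hg', hr1, hr2]
    field_simp
    ring

/-- Behind the Moon the `η`-range is `(η₂, 1)` with `η₂` the larger root of `γ η² - 2 δ η - g`. The
period is the same as behind the Earth. -/
theorem etaRange_moon_of_sq {D : ℝ} (hdel : 1 - 2 * μ = del) (hgam : 0 < gam)
    (hdel0 : 0 ≤ del) (hD : 0 < D)
    (hD2 : D ^ 2 = del ^ 2 + gam * g) (h1 : del + D < gam) :
    (etaRange μ g (-gam) .moon).Nonempty ∧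
      ∫⁻ η in etaRange μ g (-gam) .moon, ENNReal.ofReal (1 / √(h μ g (-gam) η)) =
        agmInt (4 * D) (gam + g + 2 * D) := by
  have hg' : g = (D ^ 2 - del ^ 2) / gam := by field_simp; linarith
  obtain ⟨r1, hr1⟩ : ∃ r1, r1 = (del - D) / gam := ⟨_, rfl⟩
  obtain ⟨r2, hr2⟩ : ∃ r2, r2 = (del + D) / gam := ⟨_, rfl⟩
  have hr2' : r2 < 1 := by rw [hr2, div_lt_one hgam]; linarith
  have hr2'' : -1 < r2 := by rw [hr2, lt_div_iff₀ hgam]; linarith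
  have hr12 : r1 < r2 := by rw [hr1, hr2, div_lt_div_iff_of_pos_right hgam]; linarith
  have hfac : ∀ x, h μ g (-gam) x = (x - r2) * (1 - x) * (gam * (x - r1) * (x + 1)) := by
    intro x
    rw [h_eq hdel, hg', hr1, hr2]
    field_simp
    ring
  have hrange : etaRange μ g (-gam) .moon = Set.Ioo r2 1 := by
    ext x
    simp only [etaRange, Set.mem_ofPred_eq, Set.mem_Ioo]
    constructor
    · rintro ⟨hx1, hx2, hx3⟩
      refine ⟨?_, hx2⟩
      by_contra! hx4
      have := hx3 r2 hx4 hr2'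
      rw [hfac] at this
      simp at this
    · rintro ⟨hx1, hx2⟩
      refine ⟨by linarith, hx2, fun t ht htx => ?_⟩
      rw [hfac]
      exact mul_pos (mul_pos (by linarith) (by linarith))
        (mul_pos (mul_pos hgam (by linarith)) (by linarith))
  refine ⟨hrange ▸ Set.nonempty_Ioo.2 hr2', ?_⟩
  have hQ : gam + g + 2 * D = gam * (r2 + 1) * (1 - r1) := by
    rw [hg', hr1, hr2]; field_simp; ring
  have hQ0 : 0 < gam + g + 2 * D := by
    rw [hQ]
    exact mul_pos (mul_pos hgam (by linarith)) (by linarith)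
  rw [hrange, agmInt_eq (by positivity) hQ0.le rfl]
  refine lintegral_quartic (A := gam) (B := gam * (1 - r1)) (C := -(gam * r1)) hr2'
    (fun x _ _ => by rw [hfac]; ring) ?_ ?_ (Real.sqrt_nonneg _) ?_ ?_
  · have : 0 < gam * (r2 - r1) * (r2 + 1) := mul_pos (mul_pos hgam (by linarith)) (by linarith)
    linarith
  · have : 0 < gam * (1 - r1) := mul_pos hgam (by linarith)
    linarith
  · rw [Real.sq_sqrt (by positivity), hg', hr1, hr2]
    field_simp
    ring
  · generalize √(4 * D * (gam + g + 2 * D)) = m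
    rw [hg', hr1, hr2]
    field_simp
    ring

/-- The motions surrounding both primaries. -/
theorem etaRange_surrounding (hdel : 1 - 2 * μ = del) {k : Primary}
    (hp : ∀ x, -1 ≤ x → x ≤ 1 → 0 < gam * x ^ 2 - 2 * del * x - g) :
    (etaRange μ g (-gam) k).Nonempty ∧
      ∫⁻ η in etaRange μ g (-gam) k, ENNReal.ofReal (1 / √(h μ g (-gam) η)) =
        surroundingPeriod del gam g := by
  have hpos : ∀ t, -1 < t → t < 1 → 0 < h μ g (-gam) t := by
    intro t h1 h2
    rw [h_eq hdel]
    exact mul_pos (hp t h1.le h2.le) (by nlinarith)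
  have hrange : etaRange μ g (-gam) k = Set.Ioo (-1) 1 := by
    ext x
    cases k
    · exact ⟨fun hx => ⟨hx.1, hx.2.1⟩,
        fun hx => ⟨hx.1, hx.2, fun t h1 h2 => hpos t h1 (h2.trans_lt hx.2)⟩⟩
    · exact ⟨fun hx => ⟨hx.1, hx.2.1⟩,
        fun hx => ⟨hx.1, hx.2, fun t h1 h2 => hpos t (hx.1.trans_le h1) h2⟩⟩
  have ha := hp (-1) le_rfl (by norm_num)
  have hb := hp 1 (by norm_num) le_rfl
  have hm : 0 < (gam - g) ^ 2 - 4 * del ^ 2 := by nlinarith [mul_pos ha hb]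
  refine ⟨hrange ▸ Set.nonempty_Ioo.2 (by norm_num), ?_⟩
  rw [hrange, surroundingPeriod]
  refine lintegral_quartic (A := gam) (B := -(2 * del)) (C := -g) (by norm_num)
    (fun x _ _ => by rw [h_eq hdel]; ring) (by linarith) (by linarith) (Real.sqrt_nonneg _) ?_ ?_
  · rw [Real.sq_sqrt hm.le]
    ring
  · ring

theorem etaRange_earth_eq_empty (hdel : 1 - 2 * μ = del) (hgam : 0 < gam)
    (hdel0 : 0 ≤ del) (hg : gam + 2 * del ≤ g) :
    etaRange μ g (-gam) .earth = ∅ := by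
  refine Set.eq_empty_of_forall_notMem fun x hx => ?_
  obtain ⟨hx1, hx2, hx3⟩ := hx
  have := hx3 x hx1 le_rfl
  rw [h_eq hdel, mul_pos_iff_of_pos_right (by nlinarith)] at this
  nlinarith [mul_pos hgam (mul_pos (sub_pos.2 hx1) (sub_pos.2 hx2)),
    mul_nonneg hdel0 (sub_pos.2 hx1).le]

theorem etaRange_moon_eq_empty (hdel : 1 - 2 * μ = del) (hg : gam - 2 * del < g) :
    etaRange μ g (-gam) .moon = ∅ := by
  refine Set.eq_empty_of_forall_notMem fun x hx => ?_
  obtain ⟨hx1, hx2, hx3⟩ := hx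
  have hc : Tendsto (fun t : ℝ => gam * t ^ 2 - 2 * del * t - g) (𝓝[<] 1)
      (𝓝 (gam * 1 ^ 2 - 2 * del * 1 - g)) :=
    ((show Continuous fun t : ℝ => gam * t ^ 2 - 2 * del * t - g by fun_prop).tendsto
      1).mono_left nhdsWithin_le_nhds
  have := ge_of_tendsto hc (b := 0) <| by
    filter_upwards [Ioo_mem_nhdsLT hx2] with t ht
    have h1 := hx3 t ht.1.le ht.2
    have ht2 := ht.2
    have ht1 : -1 < t := hx1.trans ht.1
    rw [h_eq hdel, mul_pos_iff_of_pos_right (by nlinarith)] at h1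
    exact h1.le
  linarith

end

section
variable {μ del gam g g₀ : ℝ} {k : Primary}

theorem xiRange_separated (hgam : 0 < gam) (hg : gam - 2 < g) :
    (xiRange g (-gam)).Nonempty ∧
      ∫⁻ ξ in xiRange g (-gam), ENNReal.ofReal (1 / √(f g (-gam) ξ)) =
        separatedPeriod 1 gam g := by
  have h1 : 0 < 1 ^ 2 + gam * g := by nlinarith [sq_nonneg (gam - 1), mul_lt_mul_of_pos_left hg hgam]
  exact xiRange_separated_of_sq hgam (Real.sqrt_pos.2 h1) (by rw [Real.sq_sqrt h1.le, one_pow]) hg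

theorem etaRange_earth (hdel : 1 - 2 * μ = del) (hdel0 : 0 ≤ del) (hgam : 0 < gam) (hg : 0 < g)
    (hg' : g < gam + 2 * del) :
    (etaRange μ g (-gam) .earth).Nonempty ∧
      ∫⁻ η in etaRange μ g (-gam) .earth, ENNReal.ofReal (1 / √(h μ g (-gam) η)) =
        separatedPeriod del gam g := by
  have h1 : 0 < gam * g := mul_pos hgam hg
  have h2 : 0 < del ^ 2 + gam * g := by positivity
  refine etaRange_earth_of_sq hdel hgam (Real.sqrt_pos.2 h2) (Real.sq_sqrt h2.le) ?_ ?_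
  · rw [Real.sqrt_lt' (by positivity)]
    nlinarith
  · have := Real.le_sqrt_of_sq_le (show del ^ 2 ≤ del ^ 2 + gam * g by linarith)
    linarith

theorem etaRange_separated (hdel : 1 - 2 * μ = del) (hdel0 : 0 ≤ del) (hgam : del < gam)
    (hg : 0 < del ^ 2 + gam * g) (hg' : g < gam - 2 * del) :
    (etaRange μ g (-gam) k).Nonempty ∧
      ∫⁻ η in etaRange μ g (-gam) k, ENNReal.ofReal (1 / √(h μ g (-gam) η)) =
        separatedPeriod del gam g := by
  have hgam0 : 0 < gam := by linarith
  have h1 : √(del ^ 2 + gam * g) < gam - del := by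
    rw [Real.sqrt_lt' (by linarith)]
    nlinarith
  cases k
  · exact etaRange_earth_of_sq hdel hgam0 (Real.sqrt_pos.2 hg) (Real.sq_sqrt hg.le)
      (by linarith) (by linarith [Real.sqrt_nonneg (del ^ 2 + gam * g)])
  · exact etaRange_moon_of_sq hdel hgam0 hdel0 (Real.sqrt_pos.2 hg) (Real.sq_sqrt hg.le)
      (by linarith)

theorem quadratic_pos_of_disc (hgam : 0 < gam) (hg : gam * g < -del ^ 2) (x : ℝ) :
    0 < gam * x ^ 2 - 2 * del * x - g := by
  refine pos_of_mul_pos_right (a := gam) ?_ hgam.le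
  nlinarith [sq_nonneg (gam * x - del)]

theorem tendsto_separatedPeriod (h1 : 0 < del ^ 2 + gam * g₀)
    (h2 : 0 < gam + g₀ + 2 * √(del ^ 2 + gam * g₀)) :
    Tendsto (separatedPeriod del gam) (𝓝 g₀) (𝓝 (separatedPeriod del gam g₀)) := by
  refine tendsto_agmInt (by positivity) h2 ?_ ?_
  · exact (show Continuous fun g => 4 * √(del ^ 2 + gam * g) by fun_prop).tendsto g₀
  · exact (show Continuous fun g => gam + g + 2 * √(del ^ 2 + gam * g) by fun_prop).tendsto g₀

theorem tendsto_surroundingPeriod (h1 : 0 < (gam - g₀) ^ 2 - 4 * del ^ 2)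
    (h2 : gam + g₀ < √((gam - g₀) ^ 2 - 4 * del ^ 2)) :
    Tendsto (surroundingPeriod del gam) (𝓝 g₀) (𝓝 (surroundingPeriod del gam g₀)) := by
  refine tendsto_ellInt (by linarith) (Real.sqrt_pos.2 h1) ?_ ?_
  · exact (show Continuous fun g => 2 * (√((gam - g) ^ 2 - 4 * del ^ 2) - gam - g)
      by fun_prop).tendsto g₀
  · exact (show Continuous fun g => √((gam - g) ^ 2 - 4 * del ^ 2) by fun_prop).tendsto g₀

theorem separatedPeriod_mem (h1 : 0 < del ^ 2 + gam * g)
    (h2 : 0 < gam + g + 2 * √(del ^ 2 + gam * g)) :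
    separatedPeriod del gam g ≠ 0 ∧ separatedPeriod del gam g ≠ ⊤ :=
  ⟨(agmInt_pos (by positivity) h2).ne', (agmInt_lt_top (by positivity) h2).ne⟩

theorem surroundingPeriod_mem (h1 : 0 < (gam - g) ^ 2 - 4 * del ^ 2)
    (h2 : gam + g < √((gam - g) ^ 2 - 4 * del ^ 2)) :
    surroundingPeriod del gam g ≠ 0 ∧ surroundingPeriod del gam g ≠ ⊤ :=
  ⟨(ellInt_pos (by linarith) (Real.sqrt_pos.2 h1)).ne',
    (ellInt_lt_top (by linarith) (Real.sqrt_pos.2 h1)).ne⟩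

/-! ### Rotation numbers as one-sided limits -/

theorem mem_accessible_and_rotation_eq {c : ℝ} {X Y : ℝ≥0∞}
    (hX : (xiRange g c).Nonempty ∧ ∫⁻ ξ in xiRange g c, ENNReal.ofReal (1 / √(f g c ξ)) = X)
    (hY : (etaRange μ g c k).Nonempty ∧
      ∫⁻ η in etaRange μ g c k, ENNReal.ofReal (1 / √(h μ g c η)) = Y) :
    g ∈ accessible k μ c ∧ rotation k μ g c = Y / X :=
  ⟨⟨hX.1, hY.1⟩, by rw [rotation_eq, hX.2, hY.2]⟩

theorem eventually_nhds_of_sides {p : ℝ → Prop} (hl : ∀ᶠ g in 𝓝[<] g₀, p g)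
    (hr : ∀ᶠ g in 𝓝[>] g₀, p g) : ∀ᶠ g in 𝓝 g₀, g ≠ g₀ → p g := by
  have : ∀ᶠ g in 𝓝[≠] g₀, p g := by
    rw [← nhdsLT_sup_nhdsGT]
    exact eventually_sup.2 ⟨hl, hr⟩
  exact eventually_nhdsWithin_iff.1 this

/-- The accessible set may be replaced by any set that agrees with it near the critical value. -/
theorem HasRotationNumber.of_nhdsWithin {c : ℝ} {r : ℝ≥0∞} {S : Set ℝ} [(𝓝[S] g₀).NeBot]
    (hS : g₀ ∉ S) (h1 : ∀ᶠ g in 𝓝 g₀, g ≠ g₀ → (g ∈ accessible k μ c ↔ g ∈ S))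
    (h2 : Tendsto (fun g => rotation k μ g c) (𝓝[S] g₀) (𝓝 r)) :
    HasRotationNumber k μ c g₀ r := by
  have h3 : 𝓝[accessible k μ c \ {g₀}] g₀ = 𝓝[S] g₀ := by
    refine nhdsWithin_eq_iff_eventuallyEq.2 (eventuallyEq_set.2 ?_)
    filter_upwards [h1] with g hg
    by_cases h : g = g₀
    · subst h
      simp [hS]
    · simp [h, hg h]
  unfold HasRotationNumber
  rw [h3]
  exact ⟨inferInstance, h2⟩

theorem HasRotationNumber.of_right {c : ℝ} {r : ℝ≥0∞} {F : ℝ → ℝ≥0∞}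
    (h1 : ∀ᶠ g in 𝓝[>] g₀, g ∈ accessible k μ c ∧ rotation k μ g c = F g)
    (h2 : ∀ᶠ g in 𝓝[<] g₀, g ∉ accessible k μ c) (h3 : Tendsto F (𝓝[>] g₀) (𝓝 r)) :
    HasRotationNumber k μ c g₀ r := by
  refine .of_nhdsWithin (S := Set.Ioi g₀) (by simp) (eventually_nhds_of_sides ?_ ?_)
    (h3.congr' (h1.mono fun g hg => hg.2.symm))
  · filter_upwards [h2, self_mem_nhdsWithin] with g hg hg'
    simpa [hg] using le_of_lt hg'
  · filter_upwards [h1, self_mem_nhdsWithin] with g hg hg'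
    simpa [hg.1] using hg'

theorem HasRotationNumber.of_left {c : ℝ} {r : ℝ≥0∞} {F : ℝ → ℝ≥0∞}
    (h1 : ∀ᶠ g in 𝓝[<] g₀, g ∈ accessible k μ c ∧ rotation k μ g c = F g)
    (h2 : ∀ᶠ g in 𝓝[>] g₀, g ∉ accessible k μ c) (h3 : Tendsto F (𝓝[<] g₀) (𝓝 r)) :
    HasRotationNumber k μ c g₀ r := by
  refine .of_nhdsWithin (S := Set.Iio g₀) (by simp) (eventually_nhds_of_sides ?_ ?_)
    (h3.congr' (h1.mono fun g hg => hg.2.symm))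
  · filter_upwards [h1, self_mem_nhdsWithin] with g hg hg'
    simpa [hg.1] using hg'
  · filter_upwards [h2, self_mem_nhdsWithin] with g hg hg'
    simpa [hg] using le_of_lt hg'

theorem HasRotationNumber.of_both {c : ℝ} {r : ℝ≥0∞} {F F' : ℝ → ℝ≥0∞}
    (h1 : ∀ᶠ g in 𝓝[<] g₀, g ∈ accessible k μ c ∧ rotation k μ g c = F g)
    (h2 : ∀ᶠ g in 𝓝[>] g₀, g ∈ accessible k μ c ∧ rotation k μ g c = F' g)
    (h3 : Tendsto F (𝓝[<] g₀) (𝓝 r)) (h4 : Tendsto F' (𝓝[>] g₀) (𝓝 r)) :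
    HasRotationNumber k μ c g₀ r := by
  refine .of_nhdsWithin (S := {g₀}ᶜ) (by simp) (eventually_nhds_of_sides ?_ ?_) ?_
  · filter_upwards [h1, self_mem_nhdsWithin] with g hg hg'
    simpa [hg.1] using ne_of_lt hg'
  · filter_upwards [h2, self_mem_nhdsWithin] with g hg hg'
    simpa [hg.1] using ne_of_gt hg'
  · rw [← nhdsLT_sup_nhdsGT]
    exact (h3.congr' (h1.mono fun g hg => hg.2.symm)).sup
      (h4.congr' (h2.mono fun g hg => hg.2.symm))

theorem eventually_lt_of_continuous {u : ℝ → ℝ} (hu : Continuous u) {a : ℝ} (ha : a < u g₀) :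
    ∀ᶠ g in 𝓝 g₀, a < u g :=
  (hu.tendsto g₀).eventually (lt_mem_nhds ha)

theorem eventually_gt_of_continuous {u : ℝ → ℝ} (hu : Continuous u) {a : ℝ} (ha : u g₀ < a) :
    ∀ᶠ g in 𝓝 g₀, u g < a :=
  (hu.tendsto g₀).eventually (gt_mem_nhds ha)

/-! ### The critical orbits -/

theorem xi_period_mem (hgam : 0 < gam) (hg : gam - 2 < g) :
    0 < 1 ^ 2 + gam * g ∧ 0 < gam + g + 2 * √(1 ^ 2 + gam * g) := by
  have h1 : 0 < 1 ^ 2 + gam * g := by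
    nlinarith [sq_nonneg (gam - 1), mul_lt_mul_of_pos_left hg hgam]
  have h2 : 1 - gam < √(1 ^ 2 + gam * g) :=
    Real.lt_sqrt_of_sq_lt (by nlinarith [mul_lt_mul_of_pos_left hg hgam])
  exact ⟨h1, by linarith⟩

/-- Tori exist for `g > γ - 2` only. The `ξ`-range shrinks to the point `1`. -/
theorem hasRotationNumber_int (hdel : 1 - 2 * μ = del) (hdel0 : 0 ≤ del) (hdel1 : del < 1)
    (hgam : 1 < gam) (hgam' : 1 - del ^ 2 < (gam - 1) ^ 2) :
    HasRotationNumber k μ (-gam) (gam - 2)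
      (separatedPeriod del gam (gam - 2) / separatedPeriod 1 gam (gam - 2)) := by
  have e1 : 0 < del ^ 2 + gam * (gam - 2) := by nlinarith
  have e2 : 0 < gam + (gam - 2) + 2 * √(del ^ 2 + gam * (gam - 2)) := by
    have := Real.sqrt_pos.2 e1
    linarith
  have e3 : 0 < 1 ^ 2 + gam * (gam - 2) := by nlinarith
  have e4 : 0 < gam + (gam - 2) + 2 * √(1 ^ 2 + gam * (gam - 2)) := by
    have := Real.sqrt_pos.2 e3
    linarith
  refine .of_right (F := fun g => separatedPeriod del gam g / separatedPeriod 1 gam g) ?_ ?_ ?_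
  · have h1 := eventually_lt_of_continuous (u := fun g => del ^ 2 + gam * g) (by fun_prop) e1
    have h2 := eventually_gt_of_continuous (u := fun g => g) continuous_id
      (show gam - 2 < gam - 2 * del by linarith)
    filter_upwards [self_mem_nhdsWithin, nhdsWithin_le_nhds h1, nhdsWithin_le_nhds h2]
      with g hg hg1 hg2
    exact mem_accessible_and_rotation_eq (xiRange_separated (by linarith) hg)
      (etaRange_separated hdel hdel0 (by linarith) hg1 hg2)
  · filter_upwards [self_mem_nhdsWithin] with g hg hg'
    have hg : g < gam - 2 := hg
    simpa [xiRange_eq_empty hgam.le hg.le] using hg'.1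
  · exact ENNReal.Tendsto.div
      ((tendsto_separatedPeriod e1 e2).mono_left nhdsWithin_le_nhds)
      (Or.inl (separatedPeriod_mem e1 e2).1)
      ((tendsto_separatedPeriod e3 e4).mono_left nhdsWithin_le_nhds)
      (Or.inl (separatedPeriod_mem e3 e4).2)

/-- Tori exist for `g < γ + 2δ` only. The `η`-range shrinks to the point `-1`. -/
theorem hasRotationNumber_extEarth (hdel : 1 - 2 * μ = del) (hdel0 : 0 ≤ del)
    (hgam : 0 < gam) :
    HasRotationNumber .earth μ (-gam) (gam + 2 * del)
      (separatedPeriod del gam (gam + 2 * del) / separatedPeriod 1 gam (gam + 2 * del)) := by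
  have e1 : 0 < del ^ 2 + gam * (gam + 2 * del) := by positivity
  have e2 : 0 < gam + (gam + 2 * del) + 2 * √(del ^ 2 + gam * (gam + 2 * del)) := by positivity
  have e0 : gam - 2 < gam + 2 * del := by linarith
  obtain ⟨e3, e4⟩ := xi_period_mem hgam e0
  refine .of_left (F := fun g => separatedPeriod del gam g / separatedPeriod 1 gam g) ?_ ?_ ?_
  · have h1 : ∀ᶠ g in 𝓝 (gam + 2 * del), 0 < g := lt_mem_nhds (by positivity)
    have h2 : ∀ᶠ g in 𝓝 (gam + 2 * del), gam - 2 < g := lt_mem_nhds e0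
    filter_upwards [self_mem_nhdsWithin, nhdsWithin_le_nhds h1, nhdsWithin_le_nhds h2]
      with g hg hg1 hg2
    exact mem_accessible_and_rotation_eq (xiRange_separated hgam hg2)
      (etaRange_earth hdel hdel0 hgam hg1 hg)
  · filter_upwards [self_mem_nhdsWithin] with g hg hg'
    have hg : gam + 2 * del < g := hg
    simpa [etaRange_earth_eq_empty hdel hgam hdel0 hg.le] using hg'.2
  · exact ENNReal.Tendsto.div
      ((tendsto_separatedPeriod e1 e2).mono_left nhdsWithin_le_nhds)
      (Or.inl (separatedPeriod_mem e1 e2).1)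
      ((tendsto_separatedPeriod e3 e4).mono_left nhdsWithin_le_nhds)
      (Or.inl (separatedPeriod_mem e3 e4).2)

/-- Tori exist for `g < γ - 2δ` only. The `η`-range shrinks to the point `1`. -/
theorem hasRotationNumber_extMoon (hdel : 1 - 2 * μ = del) (hdel0 : 0 ≤ del) (hdel1 : del < 1)
    (hgam : del < gam) :
    HasRotationNumber .moon μ (-gam) (gam - 2 * del)
      (separatedPeriod del gam (gam - 2 * del) / separatedPeriod 1 gam (gam - 2 * del)) := by
  have e1 : 0 < del ^ 2 + gam * (gam - 2 * del) := by nlinarith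
  have e2 : 0 < gam + (gam - 2 * del) + 2 * √(del ^ 2 + gam * (gam - 2 * del)) := by
    have := Real.sqrt_pos.2 e1
    linarith
  have e0 : gam - 2 < gam - 2 * del := by linarith
  obtain ⟨e3, e4⟩ := xi_period_mem (hdel0.trans_lt hgam) e0
  refine .of_left (F := fun g => separatedPeriod del gam g / separatedPeriod 1 gam g) ?_ ?_ ?_
  · have h1 := eventually_lt_of_continuous (u := fun g => del ^ 2 + gam * g) (by fun_prop) e1
    have h2 : ∀ᶠ g in 𝓝 (gam - 2 * del), gam - 2 < g := lt_mem_nhds e0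
    filter_upwards [self_mem_nhdsWithin, nhdsWithin_le_nhds h1, nhdsWithin_le_nhds h2]
      with g hg hg1 hg2
    exact mem_accessible_and_rotation_eq (xiRange_separated (by linarith) hg2)
      (etaRange_separated hdel hdel0 hgam hg1 hg)
  · filter_upwards [self_mem_nhdsWithin] with g hg hg'
    simpa [etaRange_moon_eq_empty hdel hg] using hg'.2
  · exact ENNReal.Tendsto.div
      ((tendsto_separatedPeriod e1 e2).mono_left nhdsWithin_le_nhds)
      (Or.inl (separatedPeriod_mem e1 e2).1)
      ((tendsto_separatedPeriod e3 e4).mono_left nhdsWithin_le_nhds)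
      (Or.inl (separatedPeriod_mem e3 e4).2)

theorem tendsto_div_top {α : Type*} {l : Filter α} {u v : α → ℝ≥0∞} {b : ℝ≥0∞}
    (hu : Tendsto u l (𝓝 ⊤)) (hv : Tendsto v l (𝓝 b)) (hb : b ≠ ⊤) :
    Tendsto (fun x => u x / v x) l (𝓝 ⊤) := by
  have := ENNReal.Tendsto.div hu (Or.inl ENNReal.top_ne_zero) hv (Or.inl hb)
  rwa [ENNReal.top_div_of_ne_top hb] at this

theorem tendsto_div_zero {α : Type*} {l : Filter α} {u v : α → ℝ≥0∞} {a : ℝ≥0∞}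
    (hu : Tendsto u l (𝓝 a)) (ha : a ≠ ⊤) (hv : Tendsto v l (𝓝 ⊤)) :
    Tendsto (fun x => u x / v x) l (𝓝 0) := by
  have := ENNReal.Tendsto.div hu (Or.inr ENNReal.top_ne_zero) hv (Or.inr ha)
  rwa [ENNReal.div_top] at this

/-- For `c > c_h` the `η`-range is all of `(-1, 1)`, and in the limit `1` is a double root of `h`, so
the `η`-period diverges. -/
theorem hasRotationNumber_extMoon_top (hdel : 1 - 2 * μ = del) (hdel1 : del < 1)
    (hgam : 0 < gam) (hgam' : gam < del) :
    HasRotationNumber .moon μ (-gam) (gam - 2 * del) ⊤ := by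
  have e0 : gam - 2 < gam - 2 * del := by linarith
  obtain ⟨e3, e4⟩ := xi_period_mem hgam e0
  have hm : Tendsto (fun g => √((gam - g) ^ 2 - 4 * del ^ 2)) (𝓝[<] (gam - 2 * del)) (𝓝 0) := by
    have := ((show Continuous fun g => √((gam - g) ^ 2 - 4 * del ^ 2) by fun_prop).tendsto
      (gam - 2 * del)).mono_left (nhdsWithin_le_nhds (s := Set.Iio (gam - 2 * del)))
    rwa [show (gam - (gam - 2 * del)) ^ 2 - 4 * del ^ 2 = 0 by ring, Real.sqrt_zero] at this
  have hg : Tendsto (fun g : ℝ => g) (𝓝[<] (gam - 2 * del)) (𝓝 (gam - 2 * del)) :=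
    nhdsWithin_le_nhds
  have he : Tendsto (fun g => 2 * (√((gam - g) ^ 2 - 4 * del ^ 2) - gam - g))
      (𝓝[<] (gam - 2 * del)) (𝓝 (2 * (0 - gam - (gam - 2 * del)))) :=
    ((hm.sub_const gam).sub hg).const_mul 2
  refine .of_left (F := fun g => surroundingPeriod del gam g / separatedPeriod 1 gam g) ?_ ?_ ?_
  · have h2 : ∀ᶠ g in 𝓝 (gam - 2 * del), gam - 2 < g := lt_mem_nhds e0
    filter_upwards [self_mem_nhdsWithin, nhdsWithin_le_nhds h2] with g hg hg2
    have hg : g < gam - 2 * del := hg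
    refine mem_accessible_and_rotation_eq (xiRange_separated hgam hg2)
      (etaRange_surrounding hdel fun x hx hx' => ?_)
    nlinarith [mul_nonneg (sub_nonneg.2 hx') (show 0 ≤ 2 * del - gam * (1 + x) by nlinarith)]
  · filter_upwards [self_mem_nhdsWithin] with g hg hg'
    simpa [etaRange_moon_eq_empty hdel hg] using hg'.2
  · refine tendsto_div_top ?_ ((tendsto_separatedPeriod e3 e4).mono_left nhdsWithin_le_nhds)
      (separatedPeriod_mem e3 e4).2
    refine tendsto_ellInt_top_of_right he (tendsto_nhdsWithin_iff.2 ⟨hm, ?_⟩)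
      (he.eventually (lt_mem_nhds (by linarith)))
    filter_upwards [self_mem_nhdsWithin] with g hg
    have hg : g < gam - 2 * del := hg
    exact Real.sqrt_pos.2 (by nlinarith)

theorem surrounding_dou_mem (hdel0 : 0 ≤ del) (hdel1 : del < 1)
    (hgam : gam < 1 ∨ (gam - 1) ^ 2 < 1 - del ^ 2) :
    0 < (gam - (gam - 2)) ^ 2 - 4 * del ^ 2 ∧
      gam + (gam - 2) < √((gam - (gam - 2)) ^ 2 - 4 * del ^ 2) := by
  have h1 : 0 < (gam - (gam - 2)) ^ 2 - 4 * del ^ 2 := by nlinarith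
  refine ⟨h1, ?_⟩
  rcases hgam with h2 | h2
  · have := Real.sqrt_pos.2 h1
    linarith
  · exact Real.lt_sqrt_of_sq_lt (by nlinarith)

/-- Tori exist for `g > γ - 2` only. The `ξ`-range shrinks to the point `1`. -/
theorem hasRotationNumber_dou (hdel : 1 - 2 * μ = del) (hdel0 : 0 ≤ del) (hdel1 : del < 1)
    (hgam : 1 < gam) (hgam' : (gam - 1) ^ 2 < 1 - del ^ 2) :
    HasRotationNumber k μ (-gam) (gam - 2)
      (surroundingPeriod del gam (gam - 2) / separatedPeriod 1 gam (gam - 2)) := by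
  obtain ⟨e1, e2⟩ := surrounding_dou_mem hdel0 hdel1 (Or.inr hgam')
  have e3 : 0 < 1 ^ 2 + gam * (gam - 2) := by nlinarith
  have e4 : 0 < gam + (gam - 2) + 2 * √(1 ^ 2 + gam * (gam - 2)) := by
    have := Real.sqrt_pos.2 e3
    linarith
  refine .of_right (F := fun g => surroundingPeriod del gam g / separatedPeriod 1 gam g) ?_ ?_ ?_
  · have h1 := eventually_gt_of_continuous (u := fun g => gam * g) (by fun_prop)
      (show gam * (gam - 2) < -del ^ 2 by nlinarith)
    filter_upwards [self_mem_nhdsWithin, nhdsWithin_le_nhds h1] with g hg hg1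
    exact mem_accessible_and_rotation_eq (xiRange_separated (by linarith) hg)
      (etaRange_surrounding hdel fun x _ _ => quadratic_pos_of_disc (by linarith) hg1 x)
  · filter_upwards [self_mem_nhdsWithin] with g hg hg'
    have hg : g < gam - 2 := hg
    simpa [xiRange_eq_empty hgam.le hg.le] using hg'.1
  · exact ENNReal.Tendsto.div
      ((tendsto_surroundingPeriod e1 e2).mono_left nhdsWithin_le_nhds)
      (Or.inl (surroundingPeriod_mem e1 e2).1)
      ((tendsto_separatedPeriod e3 e4).mono_left nhdsWithin_le_nhds)
      (Or.inl (separatedPeriod_mem e3 e4).2)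

/-- For `c > c_e` there are tori on both sides of `g = γ - 2`, and in the limit `1` is a double root of
`f`, so the `ξ`-period diverges. -/
theorem hasRotationNumber_dou_zero (hdel : 1 - 2 * μ = del) (hdel0 : 0 ≤ del) (hdel1 : del < 1)
    (hgam : 0 < gam) (hgam' : gam < 1) :
    HasRotationNumber k μ (-gam) (gam - 2) 0 := by
  obtain ⟨e1, e2⟩ := surrounding_dou_mem hdel0 hdel1 (Or.inl hgam')
  have hfin := (surroundingPeriod_mem e1 e2).2
  have hnum := tendsto_surroundingPeriod e1 e2
  have hfull : ∀ᶠ g in 𝓝 (gam - 2), ∀ x, -1 ≤ x → x ≤ 1 →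
      0 < gam * x ^ 2 - 2 * del * x - g := by
    filter_upwards [gt_mem_nhds (show gam - 2 < gam - 1 - del ^ 2 by nlinarith)] with g hg x h1 h2
    nlinarith [mul_nonneg (sub_pos.2 hgam').le (show 0 ≤ 1 - x ^ 2 by nlinarith),
      sq_nonneg (x - del)]
  refine .of_both (F := fun g => surroundingPeriod del gam g / surroundingPeriod 1 gam g)
    (F' := fun g => surroundingPeriod del gam g / separatedPeriod 1 gam g) ?_ ?_ ?_ ?_
  · have h1 := eventually_lt_of_continuous (u := fun g => gam * g) (by fun_prop)
      (show -1 < gam * (gam - 2) by nlinarith)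
    filter_upwards [self_mem_nhdsWithin, nhdsWithin_le_nhds h1, nhdsWithin_le_nhds hfull]
      with g hg hg1 hg2
    exact mem_accessible_and_rotation_eq (xiRange_surrounding hgam hgam' hg1 hg)
      (etaRange_surrounding hdel hg2)
  · filter_upwards [self_mem_nhdsWithin, nhdsWithin_le_nhds hfull] with g hg hg2
    exact mem_accessible_and_rotation_eq (xiRange_separated hgam hg) (etaRange_surrounding hdel hg2)
  · refine tendsto_div_zero (hnum.mono_left nhdsWithin_le_nhds) hfin ?_
    have hm : Tendsto (fun g => √((gam - g) ^ 2 - 4 * 1 ^ 2)) (𝓝[<] (gam - 2)) (𝓝 0) := by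
      have := ((show Continuous fun g => √((gam - g) ^ 2 - 4 * 1 ^ 2) by fun_prop).tendsto
        (gam - 2)).mono_left (nhdsWithin_le_nhds (s := Set.Iio (gam - 2)))
      rwa [show (gam - (gam - 2)) ^ 2 - 4 * 1 ^ 2 = 0 by ring, Real.sqrt_zero] at this
    have hg : Tendsto (fun g : ℝ => g) (𝓝[<] (gam - 2)) (𝓝 (gam - 2)) := nhdsWithin_le_nhds
    have he : Tendsto (fun g => 2 * (√((gam - g) ^ 2 - 4 * 1 ^ 2) - gam - g))
        (𝓝[<] (gam - 2)) (𝓝 (2 * (0 - gam - (gam - 2)))) :=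
      ((hm.sub_const gam).sub hg).const_mul 2
    refine tendsto_ellInt_top_of_right he (tendsto_nhdsWithin_iff.2 ⟨hm, ?_⟩)
      (he.eventually (lt_mem_nhds (by linarith)))
    filter_upwards [self_mem_nhdsWithin] with g hg
    have hg : g < gam - 2 := hg
    exact Real.sqrt_pos.2 (by nlinarith)
  · refine tendsto_div_zero (hnum.mono_left nhdsWithin_le_nhds) hfin ?_
    have hD : √(1 ^ 2 + gam * (gam - 2)) = 1 - gam := by
      rw [show 1 ^ 2 + gam * (gam - 2) = (1 - gam) ^ 2 by ring, Real.sqrt_sq (by linarith)]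
    have hP := ((show Continuous fun g => 4 * √(1 ^ 2 + gam * g) by fun_prop).tendsto
        (gam - 2)).mono_left (nhdsWithin_le_nhds (s := Set.Ioi (gam - 2)))
    have hQ := ((show Continuous fun g => gam + g + 2 * √(1 ^ 2 + gam * g) by fun_prop).tendsto
        (gam - 2)).mono_left (nhdsWithin_le_nhds (s := Set.Ioi (gam - 2)))
    rw [hD] at hP hQ
    rw [show gam + (gam - 2) + 2 * (1 - gam) = 0 by ring] at hQ
    unfold separatedPeriod
    -- Here it is the second argument of `agmInt` that tends to `0`.
    simp only [agmInt_comm (4 * _)]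
    refine tendsto_agmInt_top (by linarith) (tendsto_nhdsWithin_iff.2 ⟨hQ, ?_⟩) hP
    filter_upwards [self_mem_nhdsWithin] with g hg
    exact (xi_period_mem hgam hg).2

/-- There are tori around one primary for `g > g₀` and around both for `g < g₀`. The `η`-period
diverges on either side. -/
theorem hasRotationNumber_hyp (hdel : 1 - 2 * μ = del) (hdel0 : 0 ≤ del)
    (hgam : del < gam) (hgam' : (gam - 1) ^ 2 < 1 - del ^ 2) (hg₀ : gam * g₀ = -del ^ 2) :
    HasRotationNumber k μ (-gam) g₀ ⊤ := by
  have hgam0 : 0 < gam := by linarith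
  have e0 : gam - 2 < g₀ := lt_of_mul_lt_mul_left (a := gam) (by nlinarith) hgam0.le
  have e5 : 0 < gam + g₀ := pos_of_mul_pos_right (a := gam) (by nlinarith) hgam0.le
  obtain ⟨e3, e4⟩ := xi_period_mem hgam0 e0
  have hfin := (separatedPeriod_mem e3 e4).2
  have hden := tendsto_separatedPeriod e3 e4
  have h0 : ∀ᶠ g in 𝓝 g₀, gam - 2 < g := lt_mem_nhds e0
  refine .of_both (F := fun g => surroundingPeriod del gam g / separatedPeriod 1 gam g)
    (F' := fun g => separatedPeriod del gam g / separatedPeriod 1 gam g) ?_ ?_ ?_ ?_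
  · filter_upwards [self_mem_nhdsWithin, nhdsWithin_le_nhds h0] with g hg hg1
    have hg : gam * g < gam * g₀ := mul_lt_mul_of_pos_left hg hgam0
    exact mem_accessible_and_rotation_eq (xiRange_separated hgam0 hg1)
      (etaRange_surrounding hdel fun x _ _ => quadratic_pos_of_disc hgam0 (by linarith) x)
  · have e6 : g₀ < gam - 2 * del := lt_of_mul_lt_mul_left (a := gam) (by nlinarith) hgam0.le
    have h1 : ∀ᶠ g in 𝓝 g₀, g < gam - 2 * del := gt_mem_nhds e6
    filter_upwards [self_mem_nhdsWithin, nhdsWithin_le_nhds h0, nhdsWithin_le_nhds h1]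
      with g hg hg1 hg2
    have hg : gam * g₀ < gam * g := mul_lt_mul_of_pos_left hg hgam0
    exact mem_accessible_and_rotation_eq (xiRange_separated hgam0 hg1)
      (etaRange_separated hdel hdel0 hgam (by linarith) hg2)
  · refine tendsto_div_top ?_ (hden.mono_left nhdsWithin_le_nhds) hfin
    have hm0 : √((gam - g₀) ^ 2 - 4 * del ^ 2) = gam + g₀ := by
      rw [show (gam - g₀) ^ 2 - 4 * del ^ 2 = (gam + g₀) ^ 2 by linear_combination -4 * hg₀,
        Real.sqrt_sq e5.le]
    have hm := ((show Continuous fun g => √((gam - g) ^ 2 - 4 * del ^ 2) by fun_prop).tendsto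
        g₀).mono_left (nhdsWithin_le_nhds (s := Set.Iio g₀))
    have he := ((show Continuous fun g => 2 * (√((gam - g) ^ 2 - 4 * del ^ 2) - gam - g)
      by fun_prop).tendsto g₀).mono_left (nhdsWithin_le_nhds (s := Set.Iio g₀))
    rw [hm0] at hm he
    rw [show 2 * (gam + g₀ - gam - g₀) = 0 by ring] at he
    refine tendsto_ellInt_top_of_left (tendsto_nhdsWithin_iff.2 ⟨he, ?_⟩) hm
      (hm.eventually (lt_mem_nhds e5))
    filter_upwards [self_mem_nhdsWithin] with g hg
    have hg : gam * g < gam * g₀ := mul_lt_mul_of_pos_left hg hgam0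
    have : gam + g < √((gam - g) ^ 2 - 4 * del ^ 2) := Real.lt_sqrt_of_sq_lt (by nlinarith)
    rw [Set.mem_Ioi]
    linarith
  · refine tendsto_div_top ?_ (hden.mono_left nhdsWithin_le_nhds) hfin
    have hP := ((show Continuous fun g => 4 * √(del ^ 2 + gam * g) by fun_prop).tendsto
        g₀).mono_left (nhdsWithin_le_nhds (s := Set.Ioi g₀))
    have hQ := ((show Continuous fun g => gam + g + 2 * √(del ^ 2 + gam * g) by fun_prop).tendsto
        g₀).mono_left (nhdsWithin_le_nhds (s := Set.Ioi g₀))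
    rw [hg₀, add_neg_cancel, Real.sqrt_zero, mul_zero] at hP hQ
    refine tendsto_agmInt_top (by linarith) (tendsto_nhdsWithin_iff.2 ⟨hP, ?_⟩) hQ
    filter_upwards [self_mem_nhdsWithin] with g hg
    have hg : gam * g₀ < gam * g := mul_lt_mul_of_pos_left hg hgam0
    have := Real.sqrt_pos.2 (show 0 < del ^ 2 + gam * g by linarith)
    rw [Set.mem_Ioi]
    linarith

/-- Tori exist for `g > g₀` only. The `ξ`-range shrinks to the point `1 / γ`. -/
theorem hasRotationNumber_ell (hdel : 1 - 2 * μ = del) (hdel0 : 0 ≤ del) (hdel1 : del < 1)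
    (hgam : 0 < gam) (hgam' : gam < 1) (hg₀ : gam * g₀ = -1) :
    HasRotationNumber k μ (-gam) g₀
      (surroundingPeriod del gam g₀ / surroundingPeriod 1 gam g₀) := by
  have e5 : gam + g₀ < 0 := neg_of_mul_neg_right (a := gam) (by nlinarith) hgam.le
  have e1 : 0 < (gam - g₀) ^ 2 - 4 * del ^ 2 := by nlinarith
  have e2 : gam + g₀ < √((gam - g₀) ^ 2 - 4 * del ^ 2) := e5.trans_le (Real.sqrt_nonneg _)
  have e3 : 0 < (gam - g₀) ^ 2 - 4 * 1 ^ 2 := by nlinarith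
  have e4 : gam + g₀ < √((gam - g₀) ^ 2 - 4 * 1 ^ 2) := e5.trans_le (Real.sqrt_nonneg _)
  refine .of_right (F := fun g => surroundingPeriod del gam g / surroundingPeriod 1 gam g)
    ?_ ?_ ?_
  · have e0 : g₀ < gam - 2 := lt_of_mul_lt_mul_left (a := gam) (by nlinarith) hgam.le
    have h0 : ∀ᶠ g in 𝓝 g₀, g < gam - 2 := gt_mem_nhds e0
    have h1 := eventually_gt_of_continuous (u := fun g => gam * g) (by fun_prop)
      (show gam * g₀ < -del ^ 2 by nlinarith)
    filter_upwards [self_mem_nhdsWithin, nhdsWithin_le_nhds h0, nhdsWithin_le_nhds h1]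
      with g hg hg1 hg2
    have hg : gam * g₀ < gam * g := mul_lt_mul_of_pos_left hg hgam
    exact mem_accessible_and_rotation_eq (xiRange_surrounding hgam hgam' (by linarith) hg1)
      (etaRange_surrounding hdel fun x _ _ => quadratic_pos_of_disc hgam hg2 x)
  · filter_upwards [self_mem_nhdsWithin] with g hg hg'
    have hg : gam * g < gam * g₀ := mul_lt_mul_of_pos_left hg hgam
    simpa [xiRange_eq_empty' hgam (hg.le.trans hg₀.le)] using hg'.1
  · exact ENNReal.Tendsto.div
      ((tendsto_surroundingPeriod e1 e2).mono_left nhdsWithin_le_nhds)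
      (Or.inl (surroundingPeriod_mem e1 e2).1)
      ((tendsto_surroundingPeriod e3 e4).mono_left nhdsWithin_le_nhds)
      (Or.inl (surroundingPeriod_mem e3 e4).2)

end

/-! ### The rotation numbers in closed form -/

/-- The ratio of the two periods for the collision orbits. With `r = √(1 - κ² / (1 + c)²)` it is the
rotation number of the interior collision orbit, where `κ = 2 √(μ (1 - μ))`. -/
noncomputable def collisionRatio (r : ℝ) : ℝ≥0∞ := agmInt (4 * r) (2 + 2 * r) / agmInt 4 4

theorem agmInt_four_mem : agmInt 4 4 ≠ 0 ∧ agmInt 4 4 ≠ ⊤ :=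
  ⟨(agmInt_pos (by norm_num) (by norm_num)).ne', (agmInt_lt_top (by norm_num) (by norm_num)).ne⟩

theorem collisionRatio_one : collisionRatio 1 = 1 := by
  unfold collisionRatio
  rw [mul_one, mul_one, show (2 + 2 : ℝ) = 4 by norm_num]
  exact ENNReal.div_self agmInt_four_mem.1 agmInt_four_mem.2

theorem collisionRatio_lt {r s : ℝ} (hr : 0 < r) (hrs : r < s) :
    collisionRatio s < collisionRatio r :=
  ENNReal.div_lt_div_right agmInt_four_mem.1 agmInt_four_mem.2
    (agmInt_strictAnti (by positivity) (by positivity) (by linarith) (by linarith))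

section
variable {α : Type*} {l : Filter α} {u : α → ℝ}

theorem tendsto_collisionRatio {r : ℝ} (hr : 0 < r) (hu : Tendsto u l (𝓝 r)) :
    Tendsto (fun x => collisionRatio (u x)) l (𝓝 (collisionRatio r)) :=
  ENNReal.Tendsto.div_const (tendsto_agmInt (by positivity) (by positivity) (hu.const_mul 4)
    ((hu.const_mul 2).const_add 2)) (Or.inr agmInt_four_mem.1)

theorem tendsto_collisionRatio_top (hu : Tendsto u l (𝓝[>] 0)) :
    Tendsto (fun x => collisionRatio (u x)) l (𝓝 ⊤) := by
  rw [tendsto_nhdsWithin_iff] at hu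
  refine tendsto_div_top (tendsto_agmInt_top (Q := 2 + 2 * 0) (by norm_num)
    (tendsto_nhdsWithin_iff.2 ⟨by simpa using hu.1.const_mul 4, ?_⟩)
    ((hu.1.const_mul 2).const_add 2)) tendsto_const_nhds agmInt_four_mem.2
  filter_upwards [hu.2] with x hx
  exact mul_pos four_pos (show 0 < u x from hx)

theorem tendsto_collisionRatio_zero (hu : Tendsto u l atTop) :
    Tendsto (fun x => collisionRatio (u x)) l (𝓝 0) := by
  have h1 := tendsto_agmInt_zero (hu.const_mul_atTop four_pos)
    (tendsto_atTop_add_const_left l 2 (hu.const_mul_atTop two_pos))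
  have := ENNReal.Tendsto.div_const h1 (Or.inr agmInt_four_mem.1)
  rwa [ENNReal.zero_div] at this

theorem tendsto_agmInt_self_top (hu : Tendsto u l (𝓝[>] 0)) :
    Tendsto (fun x => agmInt (4 * u x) (4 * u x)) l (𝓝 ⊤) := by
  rw [tendsto_nhdsWithin_iff] at hu
  have h0 : ∀ᶠ x in l, 0 < 4 * u x := hu.2.mono fun x hx => mul_pos four_pos hx
  have h1 : Tendsto (fun x => 4 * u x) l (𝓝 0) := by simpa using hu.1.const_mul 4
  have h2 : Tendsto (fun x => (√(4 * u x) + √(4 * u x)) ^ 2) l (𝓝 0) := by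
    simpa using (h1.sqrt.add h1.sqrt).pow 2
  have h3 : Tendsto (fun x => √(4 * u x * (4 * u x))) l (𝓝 0) := by
    simpa using (h1.mul h1).sqrt
  refine tendsto_ellInt_top_of_left (tendsto_nhdsWithin_iff.2 ⟨h2, ?_⟩) h3 ?_
  · filter_upwards [h0] with x hx
    have := Real.sqrt_pos.2 hx
    exact pow_pos (add_pos this this) 2
  · filter_upwards [h0] with x hx
    exact Real.sqrt_pos.2 (mul_pos hx hx)

end

theorem agmInt_div_eq {w r : ℝ} (hw : 0 < w) (hr : 0 ≤ r) :
    agmInt (w * (4 * r)) (w * (2 + 2 * r)) / agmInt (w * 4) (w * 4) = collisionRatio r := by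
  rw [agmInt_smul hw (by positivity) (by positivity), agmInt_smul hw (by norm_num) (by norm_num)]
  exact ENNReal.mul_div_mul_left _ _ (by simpa using hw) (by simp)

section
variable {del gam κ : ℝ}

theorem rotation_int_eq {w : ℝ} (hκ2 : κ ^ 2 = 1 - del ^ 2) (hκ : 0 < κ) (hw : w = gam - 1)
    (hκw : κ < w) :
    separatedPeriod del gam (gam - 2) / separatedPeriod 1 gam (gam - 2) =
      collisionRatio √(1 - κ ^ 2 / w ^ 2) := by
  have hw0 : 0 < w := hκ.trans hκw
  have h1 : 0 ≤ 1 - κ ^ 2 / w ^ 2 := by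
    rw [sub_nonneg, div_le_one (by positivity)]
    gcongr
  rw [← agmInt_div_eq hw0 (Real.sqrt_nonneg _)]
  rw [separatedPeriod_eq (D := w * √(1 - κ ^ 2 / w ^ 2)) (by positivity),
    separatedPeriod_eq (D := w) hw0.le]
  · congr 2 <;> rw [hw] <;> ring
  · rw [hw]; ring
  · rw [mul_pow, Real.sq_sqrt h1, mul_sub, mul_div_cancel₀ _ (by positivity), hκ2, hw]
    ring

theorem rotation_ext_eq {v s : ℝ} (hκ2 : κ ^ 2 = 1 - del ^ 2) (hs : s ^ 2 = del ^ 2)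
    (hv : v = gam + s) (hv0 : 0 < v) :
    separatedPeriod del gam (gam + 2 * s) / separatedPeriod 1 gam (gam + 2 * s) =
      (collisionRatio √(1 + κ ^ 2 / v ^ 2))⁻¹ := by
  have h1 : 0 ≤ 1 + κ ^ 2 / v ^ 2 := by positivity
  have h2 : 0 < √(1 + κ ^ 2 / v ^ 2) := Real.sqrt_pos.2 (by positivity)
  rw [← agmInt_div_eq hv0 h2.le, ENNReal.inv_div (Or.inl (agmInt_lt_top (by positivity)
    (by positivity)).ne) (Or.inl (agmInt_pos (by positivity) (by positivity)).ne')]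
  rw [separatedPeriod_eq (del := 1) (D := v * √(1 + κ ^ 2 / v ^ 2)) (by positivity),
    separatedPeriod_eq (D := v) hv0.le]
  · congr 2 <;> rw [hv] <;> ring
  · rw [hv]; linear_combination hs
  · rw [mul_pow, Real.sq_sqrt h1, mul_add, mul_div_cancel₀ _ (by positivity), hκ2, hv]
    linear_combination hs

theorem rotation_dou_eq {w : ℝ} (hκ2 : κ ^ 2 = 1 - del ^ 2) (hκ : 0 < κ) (hw : w = gam - 1)
    (hw0 : 0 < w) :
    surroundingPeriod del gam (gam - 2) / separatedPeriod 1 gam (gam - 2) =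
      ellInt (4 * (κ - w)) (2 * κ) / agmInt (4 * w) (4 * w) := by
  rw [surroundingPeriod_eq (m := 2 * κ) (by positivity) (by linear_combination 4 * hκ2),
    separatedPeriod_eq (D := w) hw0.le (by rw [hw]; ring)]
  congr 2 <;> rw [hw] <;> ring

/-- With `m = √(1 + 4 κ² / (c - 1 / c)²)` this is the rotation number of the elliptic orbit. -/
noncomputable def ellipticRatio (m : ℝ) : ℝ≥0∞ := ellInt (2 * (m + 1)) m / ellInt 4 1

theorem ellInt_four_mem : ellInt 4 1 ≠ 0 ∧ ellInt 4 1 ≠ ⊤ :=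
  ⟨(ellInt_pos (by norm_num) (by norm_num)).ne', (ellInt_lt_top (by norm_num) (by norm_num)).ne⟩

theorem ellipticRatio_one : ellipticRatio 1 = 1 := by
  unfold ellipticRatio
  rw [show (2 * (1 + 1) : ℝ) = 4 by norm_num]
  exact ENNReal.div_self ellInt_four_mem.1 ellInt_four_mem.2

theorem ellipticRatio_lt {r s : ℝ} (hr : 0 < r) (hrs : r < s) :
    ellipticRatio s < ellipticRatio r :=
  ENNReal.div_lt_div_right ellInt_four_mem.1 ellInt_four_mem.2
    (ellInt_strictAnti (by positivity) hr (by linarith) hrs.le)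

theorem rotation_ell_eq {k g₀ : ℝ} (hκ2 : κ ^ 2 = 1 - del ^ 2) (hg₀ : gam * g₀ = -1)
    (hk : k = -gam - g₀) (hk0 : 0 < k) :
    surroundingPeriod del gam g₀ / surroundingPeriod 1 gam g₀ =
      ellipticRatio √(1 + 4 * κ ^ 2 / k ^ 2) := by
  have h1 : 0 ≤ 1 + 4 * κ ^ 2 / k ^ 2 := by positivity
  rw [surroundingPeriod_eq (m := k * √(1 + 4 * κ ^ 2 / k ^ 2)) (by positivity),
    surroundingPeriod_eq (m := k * 1) (by positivity)]
  · have e1 : 2 * (k * √(1 + 4 * κ ^ 2 / k ^ 2) - gam - g₀) =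
        k * (2 * (√(1 + 4 * κ ^ 2 / k ^ 2) + 1)) := by linear_combination (-2) * hk
    have e2 : 2 * (k * 1 - gam - g₀) = k * 4 := by linear_combination (-2) * hk
    rw [e1, e2, ellInt_smul hk0, ellInt_smul hk0]
    exact ENNReal.mul_div_mul_left _ _ (by simpa using hk0) (by simp)
  · rw [hk]
    linear_combination 4 * hg₀
  · rw [mul_pow, Real.sq_sqrt h1, mul_add, mul_div_cancel₀ _ (by positivity), hκ2, hk]
    linear_combination 4 * hg₀

end

/-! ### Dependence on the energy -/

section
variable {κ s : ℝ}

theorem div_sq_lt (hκ : 0 < κ) {c c' : ℝ} (hcc : c < c') (hc' : c' < s) :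
    κ ^ 2 / (s - c) ^ 2 < κ ^ 2 / (s - c') ^ 2 := by
  have h1 : 0 < s - c' := by linarith
  have h2 : s - c' < s - c := by linarith
  gcongr

theorem tendsto_div_sq_atBot (κ s : ℝ) :
    Tendsto (fun c => κ ^ 2 / (s - c) ^ 2) atBot (𝓝 0) := by
  refine Tendsto.div_atTop tendsto_const_nhds ((tendsto_pow_atTop two_ne_zero).comp ?_)
  exact (tendsto_atTop_add_const_left atBot s tendsto_neg_atBot_atTop).congr
    fun c => (sub_eq_add_neg s c).symm

theorem tendsto_sub_nhdsGT_zero (s : ℝ) : Tendsto (fun c : ℝ => s - c) (𝓝[<] s) (𝓝[>] 0) := by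
  refine tendsto_nhdsWithin_iff.2 ⟨?_, ?_⟩
  · have := ((continuous_sub_left s).tendsto s).mono_left (nhdsWithin_le_nhds (s := Set.Iio s))
    rwa [sub_self] at this
  · filter_upwards [self_mem_nhdsWithin] with c hc
    exact sub_pos.2 (show c < s from hc)

theorem tendsto_div_sq_nhdsGT_zero {a : ℝ} (ha : 0 < a) :
    Tendsto (fun x : ℝ => a / x ^ 2) (𝓝[>] 0) atTop := by
  have h1 := ((tendsto_pow_atTop (α := ℝ) two_ne_zero).comp
    tendsto_inv_nhdsGT_zero).const_mul_atTop ha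
  refine h1.congr fun x => ?_
  rw [Function.comp_apply, inv_pow, div_eq_mul_inv]

theorem rotInt_props (hκ : 0 < κ) :
    StrictMonoOn (fun c => collisionRatio √(1 - κ ^ 2 / (-1 - c) ^ 2)) (Set.Iio (-1 - κ)) ∧
      Tendsto (fun c => collisionRatio √(1 - κ ^ 2 / (-1 - c) ^ 2)) atBot (𝓝 1) ∧
      Tendsto (fun c => collisionRatio √(1 - κ ^ 2 / (-1 - c) ^ 2)) (𝓝[<] (-1 - κ)) (𝓝 ⊤) := by
  have hpos : ∀ c, c < -1 - κ → 0 < √(1 - κ ^ 2 / (-1 - c) ^ 2) := by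
    intro c hc
    have h1 : κ < -1 - c := by linarith
    have h2 : 0 < -1 - c := hκ.trans h1
    rw [Real.sqrt_pos, sub_pos, div_lt_one (by positivity)]
    gcongr
  refine ⟨?_, ?_, ?_⟩
  · intro c hc c' hc' hcc
    have hc' : c' < -1 - κ := hc'
    refine collisionRatio_lt (hpos c' hc') (Real.sqrt_lt_sqrt (Real.sqrt_pos.1 (hpos c' hc')).le ?_)
    have := div_sq_lt hκ hcc (show c' < -1 by linarith)
    linarith
  · rw [← collisionRatio_one]
    refine tendsto_collisionRatio one_pos ?_
    simpa using ((tendsto_div_sq_atBot κ (-1)).const_sub 1).sqrt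
  · refine tendsto_collisionRatio_top (tendsto_nhdsWithin_iff.2 ⟨?_, ?_⟩)
    · have h1 : ContinuousAt (fun c => √(1 - κ ^ 2 / (-1 - c) ^ 2)) (-1 - κ) := by
        have : (-1 - (-1 - κ)) ^ 2 ≠ 0 := by
          rw [sub_sub_cancel]
          positivity
        fun_prop (disch := assumption)
      have h2 := h1.tendsto.mono_left (nhdsWithin_le_nhds (s := Set.Iio (-1 - κ)))
      rwa [sub_sub_cancel, div_self (by positivity), sub_self, Real.sqrt_zero] at h2
    · filter_upwards [self_mem_nhdsWithin] with c hc
      exact hpos c hc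

theorem rotExt_props (hκ : 0 < κ) :
    StrictMonoOn (fun c => (collisionRatio √(1 + κ ^ 2 / (s - c) ^ 2))⁻¹) (Set.Iio s) ∧
      Tendsto (fun c => (collisionRatio √(1 + κ ^ 2 / (s - c) ^ 2))⁻¹) atBot (𝓝 1) ∧
      Tendsto (fun c => (collisionRatio √(1 + κ ^ 2 / (s - c) ^ 2))⁻¹) (𝓝[<] s) (𝓝 ⊤) := by
  refine ⟨?_, ?_, ?_⟩
  · intro c hc c' hc' hcc
    refine ENNReal.inv_lt_inv.2 (collisionRatio_lt (Real.sqrt_pos.2 (by positivity))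
      (Real.sqrt_lt_sqrt (by positivity) ?_))
    have := div_sq_lt hκ hcc hc'
    linarith
  · rw [show (1 : ℝ≥0∞) = (collisionRatio 1)⁻¹ by rw [collisionRatio_one, inv_one]]
    refine tendsto_inv_iff.2 (tendsto_collisionRatio one_pos ?_)
    simpa using ((tendsto_div_sq_atBot κ s).const_add 1).sqrt
  · rw [← ENNReal.inv_zero]
    refine tendsto_inv_iff.2 (tendsto_collisionRatio_zero (Real.tendsto_sqrt_atTop.comp
      (tendsto_atTop_add_const_left _ 1 ?_)))
    exact (tendsto_div_sq_nhdsGT_zero (by positivity)).comp (tendsto_sub_nhdsGT_zero s)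

theorem rotDou_props (hκ : 0 < κ) :
    StrictAntiOn (fun c => ellInt (4 * (κ - (-1 - c))) (2 * κ) /
        agmInt (4 * (-1 - c)) (4 * (-1 - c))) (Set.Ioo (-1 - κ) (-1)) ∧
      Tendsto (fun c => ellInt (4 * (κ - (-1 - c))) (2 * κ) /
        agmInt (4 * (-1 - c)) (4 * (-1 - c))) (𝓝[>] (-1 - κ)) (𝓝 ⊤) ∧
      Tendsto (fun c => ellInt (4 * (κ - (-1 - c))) (2 * κ) /
        agmInt (4 * (-1 - c)) (4 * (-1 - c))) (𝓝[<] (-1)) (𝓝 0) := by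
  refine ⟨?_, ?_, ?_⟩
  · rintro c ⟨hc1, hc2⟩ c' ⟨hc1', hc2'⟩ hcc
    have h1 : agmInt (4 * (-1 - c)) (4 * (-1 - c)) < agmInt (4 * (-1 - c')) (4 * (-1 - c')) :=
      agmInt_strictAnti (by linarith) (by linarith) (by linarith) (by linarith)
    have h2 : ellInt (4 * (κ - (-1 - c'))) (2 * κ) < ellInt (4 * (κ - (-1 - c))) (2 * κ) :=
      ellInt_strictAnti (by linarith) (by linarith) (by linarith) le_rfl
    have h3 : 0 < 4 * (-1 - c) := by linarith
    exact (ENNReal.div_le_div_left h1.le _).trans_lt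
      (ENNReal.div_lt_div_right (agmInt_pos h3 h3).ne' (agmInt_lt_top h3 h3).ne h2)
  · have h4 : Tendsto (fun c : ℝ => c) (𝓝[>] (-1 - κ)) (𝓝 (-1 - κ)) := nhdsWithin_le_nhds
    have hw : Tendsto (fun c : ℝ => 4 * (-1 - c)) (𝓝[>] (-1 - κ)) (𝓝 (4 * κ)) := by
      have := (h4.const_sub (-1)).const_mul 4
      rwa [sub_sub_cancel] at this
    have he : Tendsto (fun c : ℝ => 4 * (κ - (-1 - c))) (𝓝[>] (-1 - κ)) (𝓝 0) := by
      have := ((h4.const_sub (-1)).const_sub κ).const_mul 4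
      rwa [sub_sub_cancel, sub_self, mul_zero] at this
    refine tendsto_div_top ?_ (tendsto_agmInt (by positivity) (by positivity) hw hw)
      (agmInt_lt_top (by positivity) (by positivity)).ne
    refine tendsto_ellInt_top_of_left (tendsto_nhdsWithin_iff.2 ⟨he, ?_⟩) tendsto_const_nhds
      (Eventually.of_forall fun _ => by positivity)
    filter_upwards [self_mem_nhdsWithin] with c hc
    have hc : -1 - κ < c := hc
    rw [Set.mem_Ioi]
    linarith
  · have h1 := tendsto_sub_nhdsGT_zero (-1)
    refine tendsto_div_zero (a := ellInt (4 * (κ - 0)) (2 * κ)) ?_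
      (ellInt_lt_top (by linarith) (by positivity)).ne (tendsto_agmInt_self_top h1)
    exact tendsto_ellInt (by linarith) (by positivity)
      (((tendsto_nhdsWithin_iff.1 h1).1.const_sub κ).const_mul 4) tendsto_const_nhds

theorem sub_inv_pos {c : ℝ} (hc : -1 < c) (hc' : c < 0) : 0 < c - c⁻¹ := by
  have h1 : 0 < (-c)⁻¹ * (1 - c ^ 2) := mul_pos (inv_pos.2 (by linarith)) (by nlinarith)
  have h2 : c - c⁻¹ = (-c)⁻¹ * (1 - c ^ 2) := by
    have : c ≠ 0 := hc'.ne
    field_simp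
    ring
  rwa [h2]

theorem rotEll_props (hκ : 0 < κ) :
    StrictMonoOn (fun c : ℝ => ellipticRatio √(1 + 4 * κ ^ 2 / (c - c⁻¹) ^ 2)) (Set.Ioo (-1) 0) ∧
      Tendsto (fun c : ℝ => ellipticRatio √(1 + 4 * κ ^ 2 / (c - c⁻¹) ^ 2)) (𝓝[>] (-1)) (𝓝 0) ∧
      Tendsto (fun c : ℝ => ellipticRatio √(1 + 4 * κ ^ 2 / (c - c⁻¹) ^ 2)) (𝓝[<] 0) (𝓝 1) := by
  refine ⟨?_, ?_, ?_⟩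
  · rintro c ⟨hc1, hc2⟩ c' ⟨hc1', hc2'⟩ hcc
    have h1 := sub_inv_pos hc1 hc2
    have h2 : c'⁻¹ < c⁻¹ := (inv_lt_inv_of_neg hc2' hc2).2 hcc
    refine ellipticRatio_lt (Real.sqrt_pos.2 (by positivity))
      (Real.sqrt_lt_sqrt (by positivity) ?_)
    gcongr
  · have h1 : Tendsto (fun c : ℝ => c - c⁻¹) (𝓝[>] (-1)) (𝓝[>] 0) := by
      refine tendsto_nhdsWithin_iff.2 ⟨?_, ?_⟩
      · have h2 : ContinuousAt (fun c : ℝ => c - c⁻¹) (-1) := by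
          have : (-1 : ℝ) ≠ 0 := by norm_num
          fun_prop (disch := assumption)
        have h3 := h2.tendsto.mono_left (nhdsWithin_le_nhds (s := Set.Ioi (-1)))
        rwa [show (-1 : ℝ) - (-1)⁻¹ = 0 by norm_num] at h3
      · filter_upwards [Ioo_mem_nhdsGT (show (-1 : ℝ) < 0 by norm_num)] with c hc
        exact sub_inv_pos hc.1 hc.2
    have h2 : Tendsto (fun c : ℝ => √(1 + 4 * κ ^ 2 / (c - c⁻¹) ^ 2)) (𝓝[>] (-1)) atTop :=
      Real.tendsto_sqrt_atTop.comp (tendsto_atTop_add_const_left _ 1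
        ((tendsto_div_sq_nhdsGT_zero (by positivity)).comp h1))
    have h3 := tendsto_ellInt_zero
      ((tendsto_atTop_add_const_right _ 1 h2).const_mul_atTop two_pos) h2
    have := ENNReal.Tendsto.div_const h3 (Or.inr ellInt_four_mem.1)
    rwa [ENNReal.zero_div] at this
  · have h0 : Tendsto (fun c : ℝ => c) (𝓝[<] 0) (𝓝 0) := nhdsWithin_le_nhds
    have h1 : Tendsto (fun c : ℝ => c - c⁻¹) (𝓝[<] 0) atTop := by
      simpa [sub_eq_add_neg] using
        h0.add_atTop (tendsto_neg_atBot_atTop.comp tendsto_inv_nhdsLT_zero)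
    have h2 : Tendsto (fun c : ℝ => √(1 + 4 * κ ^ 2 / (c - c⁻¹) ^ 2)) (𝓝[<] 0) (𝓝 1) := by
      have h3 : Tendsto (fun c : ℝ => 4 * κ ^ 2 / (c - c⁻¹) ^ 2) (𝓝[<] 0) (𝓝 0) :=
        Tendsto.div_atTop tendsto_const_nhds ((tendsto_pow_atTop two_ne_zero).comp h1)
      simpa using (h3.const_add 1).sqrt
    rw [← ellipticRatio_one]
    exact ENNReal.Tendsto.div_const (tendsto_ellInt (by norm_num) one_pos
      ((h2.add_const 1).const_mul 2) h2) (Or.inr ellInt_four_mem.1)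

end

end EulerProblem

open EulerProblem in
/-- The rotation functions of the critical orbits of the Euler problem of two fixed centers exist
(they are unique, being given by limits) and depend on the energy as follows. -/
theorem proposition1p1 (μ : ℝ) (hμ : 0 < μ) (hμ' : μ ≤ 1 / 2) :
    ∃ Rint RextE RextM Rdou Rhyp Rell : ℝ → ℝ≥0∞,
      -- these are the rotation functions of the critical orbits
      ((∀ c, c < cJ μ → IsRotInt μ c (Rint c)) ∧
        (∀ c, c < 0 → IsRotExtEarth μ c (RextE c)) ∧
        (∀ c, c < 0 → c ≠ ch μ → IsRotExtMoon μ c (RextM c)) ∧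
        (∀ c, cJ μ < c → c < 0 → c ≠ ce → IsRotDou μ c (Rdou c)) ∧
        (∀ c, cJ μ < c → c < ch μ → IsRotHyp μ c (Rhyp c)) ∧
        (∀ c, ce < c → c < 0 → IsRotEll μ c (Rell c))) ∧
      -- (a)
      (StrictMonoOn Rint (Set.Iio (cJ μ)) ∧
        Tendsto Rint atBot (𝓝 1) ∧ Tendsto Rint (𝓝[<] cJ μ) (𝓝 ⊤)) ∧
      -- (b)
      (StrictMonoOn RextE (Set.Iio 0) ∧ Tendsto RextE atBot (𝓝 1) ∧
        (μ = 1 / 2 → Tendsto RextE (𝓝[<] 0) (𝓝 ⊤))) ∧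
      -- (c)
      (StrictMonoOn RextM (Set.Iio (ch μ)) ∧
        Tendsto RextM atBot (𝓝 1) ∧ Tendsto RextM (𝓝[<] ch μ) (𝓝 ⊤) ∧
        ∀ c ∈ Set.Ioo (ch μ) 0, RextM c = ⊤) ∧
      -- (d)
      (StrictAntiOn Rdou (Set.Ioo (cJ μ) ce) ∧
        Tendsto Rdou (𝓝[>] cJ μ) (𝓝 ⊤) ∧ Tendsto Rdou (𝓝[<] ce) (𝓝 0) ∧
        ∀ c ∈ Set.Ioo ce 0, Rdou c = 0) ∧
      -- (e)
      (∀ c ∈ Set.Ioo (cJ μ) (ch μ), Rhyp c = ⊤) ∧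
      -- (f)
      (StrictMonoOn Rell (Set.Ioo ce 0) ∧
        Tendsto Rell (𝓝[>] ce) (𝓝 0) ∧ Tendsto Rell (𝓝[<] 0) (𝓝 1)) := by
  obtain ⟨del, hdel⟩ : ∃ del, 1 - 2 * μ = del := ⟨_, rfl⟩
  obtain ⟨κ, hκ⟩ : ∃ κ, κ = 2 * √(μ * (1 - μ)) := ⟨_, rfl⟩
  have hdel0 : 0 ≤ del := by linarith
  have hdel1 : del < 1 := by linarith
  have hμ0 : 0 < μ * (1 - μ) := mul_pos hμ (by linarith)
  have hκ0 : 0 < κ := by rw [hκ]; positivity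
  have hκ2 : κ ^ 2 = 1 - del ^ 2 := by
    rw [hκ, mul_pow, Real.sq_sqrt hμ0.le, ← hdel]
    ring
  have hcJ : cJ μ = -1 - κ := by rw [hκ, cJ]
  have hch : ch μ = -del := by rw [← hdel, ch]; ring
  have hce : ce = -1 := rfl
  -- Hence `1 - κ ≤ δ`, so that `c_J < c < c_h` implies `|c + 1| < κ`.
  have hκdel : 1 ≤ κ + del := by nlinarith [mul_nonneg hκ0.le hdel0]
  rw [hcJ, hch, hce]
  have hE := rotExt_props (κ := κ) (s := del) hκ0
  have hM := rotExt_props (κ := κ) (s := -del) hκ0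
  have hD := rotDou_props hκ0
  let RM : ℝ → ℝ≥0∞ := fun c =>
    if c < -del then (collisionRatio √(1 + κ ^ 2 / (-del - c) ^ 2))⁻¹ else ⊤
  let RD : ℝ → ℝ≥0∞ := fun c =>
    if c < -1 then ellInt (4 * (κ - (-1 - c))) (2 * κ) / agmInt (4 * (-1 - c)) (4 * (-1 - c))
    else 0
  have hRM : ∀ c, c < -del → (collisionRatio √(1 + κ ^ 2 / (-del - c) ^ 2))⁻¹ = RM c :=
    fun c hc => (if_pos hc).symm
  have hRD : ∀ c, c < -1 → ellInt (4 * (κ - (-1 - c))) (2 * κ) /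
      agmInt (4 * (-1 - c)) (4 * (-1 - c)) = RD c := fun c hc => (if_pos hc).symm
  refine ⟨fun c => collisionRatio √(1 - κ ^ 2 / (-1 - c) ^ 2),
    fun c => (collisionRatio √(1 + κ ^ 2 / (del - c) ^ 2))⁻¹, RM, RD, fun _ => ⊤,
    fun c => ellipticRatio √(1 + 4 * κ ^ 2 / (c - c⁻¹) ^ 2), ⟨?_, ?_, ?_, ?_, ?_, ?_⟩,
    rotInt_props hκ0, ⟨?_, hE.2.1, ?_⟩, ⟨?_, ?_, ?_, ?_⟩, ⟨?_, ?_, ?_, ?_⟩, fun _ _ => rfl,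
    rotEll_props hκ0⟩
  · intro c hc k
    have h1 := hasRotationNumber_int (k := k) (gam := -c) hdel hdel0 hdel1 (by linarith)
      (by rw [← hκ2]; nlinarith)
    rwa [rotation_int_eq (w := -1 - c) hκ2 hκ0 (by ring) (by linarith), neg_neg] at h1
  · intro c hc
    have h1 := hasRotationNumber_extEarth (gam := -c) hdel hdel0 (by linarith)
    rw [rotation_ext_eq (v := del - c) hκ2 rfl (by ring) (by linarith), neg_neg] at h1
    rwa [IsRotExtEarth, hdel]
  · intro c hc hc'
    rw [IsRotExtMoon, hdel]
    rcases lt_or_gt_of_ne hc' with h2 | h2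
    · have h1 := hasRotationNumber_extMoon (gam := -c) hdel hdel0 hdel1 (by linarith)
      rw [show -c - 2 * del = -c + 2 * -del by ring,
        rotation_ext_eq (v := -del - c) hκ2 (neg_sq del) (by ring) (by linarith), neg_neg,
        hRM c h2] at h1
      rwa [show -c - 2 * del = -c + 2 * -del by ring]
    · have h1 := hasRotationNumber_extMoon_top (gam := -c) hdel hdel1 (by linarith) (by linarith)
      rw [neg_neg] at h1
      rwa [show RM c = ⊤ from if_neg (by linarith)]
  · intro c hc hc0 hc' k
    rcases lt_or_gt_of_ne hc' with h2 | h2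
    · have h1 := hasRotationNumber_dou (k := k) (gam := -c) hdel hdel0 hdel1 (by linarith)
        (by rw [← hκ2]; nlinarith)
      rwa [rotation_dou_eq (w := -1 - c) hκ2 hκ0 (by ring) (by linarith), neg_neg, hRD c h2] at h1
    · have h1 := hasRotationNumber_dou_zero (k := k) (gam := -c) hdel hdel0 hdel1
        (by linarith) (by linarith)
      rw [neg_neg] at h1
      rwa [show RD c = 0 from if_neg (by linarith)]
  · intro c hc hc' k
    rw [hdel]
    have hc0 : c ≠ 0 := by linarith
    have h1 := hasRotationNumber_hyp (k := k) (gam := -c) (g₀ := del ^ 2 / c) hdel hdel0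
      (by linarith) (by rw [← hκ2]; nlinarith) (by field_simp)
    rwa [neg_neg] at h1
  · intro c hc hc' k
    have h0 : c ≠ 0 := hc'.ne
    have h1 := hasRotationNumber_ell (k := k) (gam := -c) (g₀ := 1 / c) hdel hdel0 hdel1
      (by linarith) (by linarith) (by field_simp)
    rwa [rotation_ell_eq (k := c - c⁻¹) hκ2 (by field_simp) (by ring) (sub_inv_pos hc hc'),
      neg_neg] at h1
  · exact hE.1.mono (Set.Iio_subset_Iio hdel0)
  · intro h
    have h0 : del = 0 := by linarith
    have := hE.2.2
    rwa [h0] at this ⊢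
  · exact hM.1.congr fun c hc => hRM c hc
  · exact hM.2.1.congr' ((eventually_lt_atBot (-del)).mono hRM)
  · exact hM.2.2.congr' (by filter_upwards [self_mem_nhdsWithin] with c hc using hRM c hc)
  · exact fun c hc => if_neg hc.1.le.not_gt
  · exact hD.1.congr fun c hc => hRD c hc.2
  · refine hD.2.1.congr' ?_
    filter_upwards [Ioo_mem_nhdsGT (show -1 - κ < -1 by linarith)] with c hc using hRD c hc.2
  · exact hD.2.2.congr' (by filter_upwards [self_mem_nhdsWithin] with c hc using hRD c hc)
  · exact fun c hc => if_neg hc.1.le.not_gt
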